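/- **Setting.** Let $M_k$ be the space of complex $k\times k$ matrices with the inner product $\langle C,D\rangle=\operatorname{tr}(CD^*)$, and identify $M_k\otimes M_m$ with $M_{km}$ through the Kronecker product. * A *Hermitian Schmidt decomposition* of $A\in M_k\otimes M_m$ is a finite (possibly empty) sum $A=\sum_{i=1}^n\lambda_i\,\gamma_i\otimes\delta_i$ with all $\lambda_i>0$, where $\gamma_1,\dots,\gamma_n\in M_k$ are Hermitian and orthonormal, and so are $\delta_1,\dots,\delta_n\in M_m$. * A positive semidefinite Hermitian $A\in M_k\otimes M_k$ is *SPC* if it has a Hermitian Schmidt decomposition $\sum_i\lambda_i\,\gamma_i\otimes\gamma_i$. A positive semidefinite Hermitian $A\in M_k\otimes M_m$ is *PPT* if its transpose in the first tensor factor is also positive semidefinite Hermitian. * $A\in M_k\otimes M_m$ is *separable* if $A=\sum_{i=1}^n C_i\otimes D_i$ with all $C_i\in M_k$, $D_i\in M_m$ positive semidefinite Hermitian. Its *tensor rank* is the least number of nonzero tensors $C\otimes D$ ($C\in M_k$, $D\in M_m$) whose sum is $A$. * A positive semidefinite Hermitian $A\in M_k\otimes M_m$ is *weak irreducible* if for all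 Hermitian projections $V_1,V_2\in M_k$, $W_1,W_2\in M_m$ with $V_1V_2=0$, $W_1W_2=0$, $V_1+V_2=\mathrm{Id}$, $W_1+W_2=\mathrm{Id}$: whenever $A=\sum_{i=1}^2(V_i\otimes W_i)A(V_i\otimes W_i)$, then $(V_1\otimes W_1)A(V_1\otimes W_1)=0$ or $(V_2\otimes W_2)A(V_2\otimes W_2)=0$. * A *split decomposition* of a PPT matrix $A$ is obtained as follows. Take a Hermitian Schmidt decomposition $A=\sum_{i=1}^n\lambda_i\,\gamma_i\otimes\delta_i$ with $\lambda_1=\dots=\lambda_s>\lambda_{s+1}\ge\dots\ge\lambda_n$, $s\ge1$, and a Hermitian Schmidt decomposition $\sum_{i=1}^s\gamma_i\otimes\delta_i=\sum_{i=1}^s\gamma_i'\otimes\delta_i'$ (all coefficients $1$) with all $\gamma_i',\delta_i'$ positive semidefinite. For $i\le s$ let $V_i$, $W_i$ be the Hermitian projections onto the images of $\gamma_i'$, $\delta_i'$, and let $V_{s+1}$, $W_{s+1}$ be the Hermitian projections onto the orthogonal complements of the sums of the images of the $\gamma_i'$, respectively of the $\delta_i'$. Its *terms* are $A_i=(V_i\otimes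 W_i)A(V_i\otimes W_i)$, $1\le i\le s+1$. A split decomposition of an SPC matrix is defined in the same way, with $\delta_i=\gamma_i$, $\delta_i'=\gamma_i'$ and $W_i=V_i$. * A *split reduction* of $A$ is a finite list of matrices obtained recursively: if $A$ is weak irreducible, the list is $[A]$; if it is not, the list is the concatenation of split reductions of the terms of a split decomposition of $A$. For SPC (PPT) matrices, the SPC (PPT) form of the split decomposition is used throughout. **Statement.** Let $A$ be an SPC matrix in $M_k\otimes M_k$ (respectively, a PPT matrix in $M_k\otimes M_m$). 1. If $A\neq0$, then $A$ has a split decomposition. For every split decomposition of $A$, with terms $A_1,\dots,A_{s+1}$: $A=\sum_{i=1}^{s+1}A_i$; every $A_i$ is again SPC (respectively PPT); $A$ is separable if and only if every $A_i$ is separable; and if $A$ is not weak irreducible, then every $A_i$ has strictly smaller tensor rank than $A$. 2. To decide whether $A$ is separable, it suffices to decide separability among weak irreducible matrices of the same type: $A$ has a split reduction, and for every split reduction $L$ of $A$, every member of $L$ is SPC (respectively PPT) and weak irreducible, and if $Q$ is any criterion such that, for every weak irreducible SPC (respectively PPT) matrix $B$ of the same size as $A$, $Q(B)$ holds if and only if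 $B$ is separable, then $A$ is separable if and only if $Q(B)$ holds for every $B$ in $L$. -/

import Mathlib

open scoped Kronecker ComplexOrder

/-- `M_k`, the complex `k × k` matrices. -/
abbrev Mat (k : ℕ) : Type := Matrix (Fin k) (Fin k) ℂ

/-- `M_k ⊗ M_m`, realised as `M_{km}` through the Kronecker product `⊗ₖ`. -/
abbrev BiMat (k m : ℕ) : Type := Matrix (Fin k × Fin m) (Fin k × Fin m) ℂ

/-- A finite family of matrices is orthonormal for `⟨C, D⟩ = tr (C D*)`. -/
def TraceOrthonormal {k : ℕ} {ι : Type} [DecidableEq ι] (γ : ι → Mat k) : Prop :=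
  ∀ i j, Matrix.trace (γ i * (γ j).conjTranspose) = if i = j then 1 else 0

/-- `A = ∑ i, c i • γ i ⊗ δ i` is a Hermitian Schmidt decomposition of `A`. The index type may be
empty, which gives the decomposition of `0`. -/
structure IsHermitianSchmidtDecomposition {k m : ℕ} {ι : Type} [Fintype ι] [DecidableEq ι]
    (A : BiMat k m) (c : ι → ℝ) (γ : ι → Mat k) (δ : ι → Mat m) : Prop where
  pos : ∀ i, 0 < c i
  left_hermitian : ∀ i, (γ i).IsHermitian
  right_hermitian : ∀ i, (δ i).IsHermitian
  left_orthonormal : TraceOrthonormal γ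
  right_orthonormal : TraceOrthonormal δ
  eq_sum : A = ∑ i, (c i : ℂ) • (γ i ⊗ₖ δ i)

/-- Symmetric with positive coefficients. -/
def IsSPC {k : ℕ} (A : BiMat k k) : Prop :=
  A.PosSemidef ∧ ∃ (n : ℕ) (c : Fin n → ℝ) (γ : Fin n → Mat k),
    IsHermitianSchmidtDecomposition A c γ γ

/-- Transposition in the first tensor factor. -/
def partialTranspose {k m : ℕ} (A : BiMat k m) : BiMat k m :=
  Matrix.of fun p q => A (q.1, p.2) (p.1, q.2)

/-- Positive under partial transposition. -/
def IsPPT {k m : ℕ} (A : BiMat k m) : Prop :=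
  A.PosSemidef ∧ (partialTranspose A).PosSemidef

/-- `A` is a finite sum of tensor products of positive semidefinite Hermitian matrices. -/
def IsSeparableMatrix {k m : ℕ} (A : BiMat k m) : Prop :=
  ∃ (n : ℕ) (C : Fin n → Mat k) (D : Fin n → Mat m),
    (∀ i, (C i).PosSemidef) ∧ (∀ i, (D i).PosSemidef) ∧ A = ∑ i, C i ⊗ₖ D i

/-- The least number of nonzero elementary tensors of which `A` is the sum. -/
noncomputable def tensorRank {k m : ℕ} (A : BiMat k m) : ℕ :=
  sInf {n : ℕ | ∃ (C : Fin n → Mat k) (D : Fin n → Mat m),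
    (∀ i, C i ⊗ₖ D i ≠ 0) ∧ A = ∑ i, C i ⊗ₖ D i}

/-- A Hermitian (that is, orthogonal) projection. -/
def IsHermitianProjection {k : ℕ} (P : Mat k) : Prop :=
  P.IsHermitian ∧ P * P = P

/-- The Hermitian projection onto `S`. -/
def IsHermitianProjectionOnto {k : ℕ} (P : Mat k) (S : Set (Fin k → ℂ)) : Prop :=
  IsHermitianProjection P ∧ Set.range P.mulVec = S

/-- The compression `(V ⊗ W) A (V ⊗ W)`. -/
def compress {k m : ℕ} (V : Mat k) (W : Mat m) (A : BiMat k m) : BiMat k m :=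
  (V ⊗ₖ W) * A * (V ⊗ₖ W)

/-- Weak irreducibility of a positive semidefinite Hermitian matrix. -/
def IsWeakIrreducible {k m : ℕ} (A : BiMat k m) : Prop :=
  A.PosSemidef ∧ ∀ (V₁ V₂ : Mat k) (W₁ W₂ : Mat m),
    IsHermitianProjection V₁ → IsHermitianProjection V₂ →
    IsHermitianProjection W₁ → IsHermitianProjection W₂ →
    V₁ * V₂ = 0 → W₁ * W₂ = 0 → V₁ + V₂ = 1 → W₁ + W₂ = 1 →
    A = compress V₁ W₁ A + compress V₂ W₂ A →
    compress V₁ W₁ A = 0 ∨ compress V₂ W₂ A = 0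

/-- `V 0, …, V (s - 1)` are the Hermitian projections onto the images of
`ε 0, …, ε (s - 1)`, and `V s` is the Hermitian projection onto the orthogonal complement of
the sum of these images. -/
def IsProjectionSystem {k s : ℕ} (ε : Fin s → Mat k) (V : Fin (s + 1) → Mat k) : Prop :=
  (∀ i : Fin s, IsHermitianProjectionOnto (V i.castSucc) (Set.range (ε i).mulVec)) ∧
  IsHermitianProjectionOnto (V (Fin.last s))
    {x | ∀ (i : Fin s) (y : Fin k → ℂ), star ((ε i).mulVec y) ⬝ᵥ x = 0}

/-- The data that enter a split decomposition of `A`: a Hermitian Schmidt decomposition of `A`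
with largest coefficient `μ`, of multiplicity `s ≥ 1` (the indices `Sum.inl i`), and other
coefficients `ν j < μ` (the indices `Sum.inr j`); a Hermitian Schmidt decomposition of
`D = ∑ i, γ (Sum.inl i) ⊗ δ (Sum.inl i)` with coefficients `1` and positive semidefinite
factors `γ' i`, `δ' i`; and the associated projections `V`, `W`. -/
structure IsSplitData {k m s t : ℕ} (A : BiMat k m) (μ : ℝ) (ν : Fin t → ℝ)
    (γ : Fin s ⊕ Fin t → Mat k) (δ : Fin s ⊕ Fin t → Mat m)
    (γ' : Fin s → Mat k) (δ' : Fin s → Mat m)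
    (V : Fin (s + 1) → Mat k) (W : Fin (s + 1) → Mat m) : Prop where
  one_le : 1 ≤ s
  lt_top : ∀ j, ν j < μ
  schmidt : IsHermitianSchmidtDecomposition A (Sum.elim (fun _ => μ) ν) γ δ
  schmidt_top : IsHermitianSchmidtDecomposition
    (∑ i : Fin s, γ (Sum.inl i) ⊗ₖ δ (Sum.inl i)) (fun _ => 1) γ' δ'
  left_posSemidef : ∀ i, (γ' i).PosSemidef
  right_posSemidef : ∀ i, (δ' i).PosSemidef
  left_projections : IsProjectionSystem γ' V
  right_projections : IsProjectionSystem δ' W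

/-- `T` lists the terms `(V i ⊗ W i) A (V i ⊗ W i)` of a split decomposition of `A`, in the form
used for PPT matrices. -/
def IsPPTSplitDecomposition {k m : ℕ} (s : ℕ) (A : BiMat k m)
    (T : Fin (s + 1) → BiMat k m) : Prop :=
  ∃ (t : ℕ) (μ : ℝ) (ν : Fin t → ℝ) (γ : Fin s ⊕ Fin t → Mat k) (δ : Fin s ⊕ Fin t → Mat m)
    (γ' : Fin s → Mat k) (δ' : Fin s → Mat m)
    (V : Fin (s + 1) → Mat k) (W : Fin (s + 1) → Mat m),
    IsSplitData A μ ν γ δ γ' δ' V W ∧ ∀ i, T i = compress (V i) (W i) A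

/-- `T` lists the terms `(V i ⊗ V i) A (V i ⊗ V i)` of a split decomposition of `A`, in the form
used for SPC matrices: the two tensor factors carry the same data. -/
def IsSPCSplitDecomposition {k : ℕ} (s : ℕ) (A : BiMat k k)
    (T : Fin (s + 1) → BiMat k k) : Prop :=
  ∃ (t : ℕ) (μ : ℝ) (ν : Fin t → ℝ) (γ : Fin s ⊕ Fin t → Mat k)
    (γ' : Fin s → Mat k) (V : Fin (s + 1) → Mat k),
    IsSplitData A μ ν γ γ γ' γ' V V ∧ ∀ i, T i = compress (V i) (V i) A

/-- `SplitReduction step A L`: the finite list `L` is what remains of `A` if every matrix that is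
not weak irreducible is replaced by the terms of a split decomposition of it (`step`), these
terms are treated in the same way, and so on, and the weak irreducible ones are kept. -/
inductive SplitReduction {k m : ℕ}
    (step : (s : ℕ) → BiMat k m → (Fin (s + 1) → BiMat k m) → Prop) :
    BiMat k m → List (BiMat k m) → Prop
  | keep (A : BiMat k m) : IsWeakIrreducible A → SplitReduction step A [A]
  | split (A : BiMat k m) (s : ℕ) (T : Fin (s + 1) → BiMat k m)
      (L : Fin (s + 1) → List (BiMat k m)) :
      ¬ IsWeakIrreducible A → step s A T → (∀ i, SplitReduction step (T i) (L i)) →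
      SplitReduction step A (List.ofFn L).flatten

/-!
Regard `A` as the real bilinear form `(X, Y) ↦ tr (A (X ⊗ Y))` on pairs of Hermitian matrices. The
largest coefficient `μ` of a Hermitian Schmidt decomposition is the norm of this form. Since
`A ≥ 0`, replacing `X` and `Y` by their absolute values keeps their norms and does not decrease the
form, so the space of singular vectors with singular value `μ` is closed under taking positive
parts.

If `X`, `Y` are positive semidefinite singular vectors with supports `V`, `W`, then positivity of
`A` forces the mixed blocks `A (V ⊗ (1 - W))` and `A ((1 - V) ⊗ W)` to vanish. The off-diagonal
blocks then vanish as well: for PPT matrices because the partial transpose turns them into mixed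
blocks of another positive semidefinite matrix, for SPC matrices because
`∑ λ_i |tr (γ_i X)|² = tr (A (X ⊗ X*))`. So the singular space is cut into pieces by the supports of
its positive elements, and minimal pieces provide an orthonormal basis of mutually annihilating
positive semidefinite matrices: this is a split decomposition, and it is block diagonal.

The tensor rank of a block drops as soon as some other block `j` is nonzero. Otherwise the left
factors of a shortest decomposition of `A` would stay independent when compressed to block `i`; as
`A` vanishes on the mixed blocks, block `j` of each right factor would then be zero.
-/

open Matrix

section Hermitian

theorem isHermitian_sum {n ι : Type*} (s : Finset ι) {X : ι → Matrix n n ℂ}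
    (hX : ∀ i ∈ s, (X i).IsHermitian) : (∑ i ∈ s, X i).IsHermitian := by
  rw [IsHermitian, conjTranspose_sum]
  exact Finset.sum_congr rfl hX

variable {n : Type*} [Fintype n]

theorem trace_mul_nonneg_of_posSemidef {A B : Matrix n n ℂ} (hA : A.PosSemidef)
    (hB : B.PosSemidef) : 0 ≤ (A * B).trace := by
  classical
  open scoped MatrixOrder in
  obtain ⟨C, rfl⟩ := CStarAlgebra.nonneg_iff_eq_star_mul_self.mp hA.nonneg
  rw [Matrix.mul_assoc, trace_mul_comm]
  exact (hB.mul_mul_conjTranspose_same C).trace_nonneg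

theorem mul_eq_zero_of_posSemidef_of_trace_mul_eq_zero {A B : Matrix n n ℂ} (hA : A.PosSemidef)
    (hB : B.PosSemidef) (h : (A * B).trace = 0) : A * B = 0 := by
  classical
  open scoped MatrixOrder in
  obtain ⟨⟨C, rfl⟩, ⟨D, rfl⟩⟩ := And.intro
    (CStarAlgebra.nonneg_iff_eq_star_mul_self.mp hA.nonneg)
    (CStarAlgebra.nonneg_iff_eq_star_mul_self.mp hB.nonneg)
  simp only [star_eq_conjTranspose] at h ⊢
  have trace_eq : ((C * Dᴴ)ᴴ * (C * Dᴴ)).trace = 0 := by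
    rw [← h, conjTranspose_mul, conjTranspose_conjTranspose, Matrix.mul_assoc, trace_mul_comm D]
    simp only [Matrix.mul_assoc]
  have mul_eq : C * Dᴴ = 0 := trace_conjTranspose_mul_self_eq_zero_iff.mp trace_eq
  rw [Matrix.mul_assoc, ← Matrix.mul_assoc C, mul_eq, Matrix.zero_mul, Matrix.mul_zero]

theorem exists_posSemidef_sub_of_isHermitian {X : Matrix n n ℂ} (hX : X.IsHermitian) :
    ∃ P N : Matrix n n ℂ, P.PosSemidef ∧ N.PosSemidef ∧ X = P - N ∧ P * N = 0 := by
  classical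
  open scoped MatrixOrder Matrix.Norms.L2Operator in
  exact ⟨X⁺, X⁻, (CFC.posPart_nonneg X).posSemidef, (CFC.negPart_nonneg X).posSemidef,
    (CFC.posPart_sub_negPart X hX).symm, CFC.posPart_mul_negPart X⟩

theorem mul_eq_zero_comm_of_isHermitian {X Y : Matrix n n ℂ} (hX : X.IsHermitian)
    (hY : Y.IsHermitian) : X * Y = 0 ↔ Y * X = 0 := by
  rw [← conjTranspose_eq_zero, conjTranspose_mul, hX.eq, hY.eq]

theorem ofReal_re_trace_mul_of_isHermitian {X Y : Matrix n n ℂ} (hX : X.IsHermitian)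
    (hY : Y.IsHermitian) : ((X * Y).trace.re : ℂ) = (X * Y).trace := by
  refine Complex.conj_eq_iff_re.mp ?_
  rw [starRingEnd_apply, ← trace_conjTranspose, conjTranspose_mul, hX.eq, hY.eq, trace_mul_comm]

theorem trace_mul_self_nonneg_of_isHermitian {X : Matrix n n ℂ} (hX : X.IsHermitian) :
    0 ≤ (X * X).trace := by
  simpa only [hX.eq] using (posSemidef_conjTranspose_mul_self X).trace_nonneg

theorem trace_mul_self_eq_zero_iff_of_isHermitian {X : Matrix n n ℂ} (hX : X.IsHermitian) :
    (X * X).trace = 0 ↔ X = 0 := by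
  simpa only [hX.eq] using trace_conjTranspose_mul_self_eq_zero_iff (A := X)

end Hermitian

section Kronecker

variable {k m : ℕ}

@[elab_as_elim]
theorem BiMat.kronecker_induction {P : BiMat k m → Prop} (A : BiMat k m) (zero : P 0)
    (add : ∀ A B, P A → P B → P (A + B)) (kronecker : ∀ X Y, P (X ⊗ₖ Y)) : P A := by
  induction A using Matrix.induction_on' with
  | h_zero => exact zero
  | h_add A B hA hB => exact add A B hA hB
  | h_std_basis p q x =>
    simpa only [single_kronecker_single, mul_one] using
      kronecker (single p.1 q.1 x) (single p.2 q.2 1)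

theorem BiMat.ext_trace_mul_kronecker {A B : BiMat k m}
    (h : ∀ X Y, (A * (X ⊗ₖ Y)).trace = (B * (X ⊗ₖ Y)).trace) : A = B := by
  refine Matrix.ext_iff_trace_mul_right.mpr fun M => ?_
  induction M using BiMat.kronecker_induction with
  | zero => simp only [Matrix.mul_zero]
  | add M N hM hN => simp only [Matrix.mul_add, trace_add, hM, hN]
  | kronecker X Y => exact h X Y

theorem trace_kronecker_mul_kronecker (X Z : Mat k) (Y T : Mat m) :
    ((X ⊗ₖ Y) * (Z ⊗ₖ T)).trace = (X * Z).trace * (Y * T).trace := by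
  rw [← mul_kronecker_mul, trace_kronecker]

theorem sum_kronecker {ι : Type*} (s : Finset ι) (X : ι → Mat k) (Y : Mat m) :
    (∑ i ∈ s, X i) ⊗ₖ Y = ∑ i ∈ s, X i ⊗ₖ Y :=
  map_sum ((kroneckerBilinear (R := ℂ) (α := ℂ)).flip Y) X s

theorem kronecker_sum {ι : Type*} (s : Finset ι) (X : Mat k) (Y : ι → Mat m) :
    X ⊗ₖ (∑ i ∈ s, Y i) = ∑ i ∈ s, X ⊗ₖ Y i :=
  map_sum (kroneckerBilinear (R := ℂ) (α := ℂ) X) Y s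

theorem sub_kronecker (X X' : Mat k) (Y : Mat m) : (X - X') ⊗ₖ Y = X ⊗ₖ Y - X' ⊗ₖ Y :=
  map_sub ((kroneckerBilinear (R := ℂ) (α := ℂ)).flip Y) X X'

theorem kronecker_sub (X : Mat k) (Y Y' : Mat m) : X ⊗ₖ (Y - Y') = X ⊗ₖ Y - X ⊗ₖ Y' :=
  map_sub (kroneckerBilinear (R := ℂ) (α := ℂ) X) Y Y'

theorem isHermitian_kronecker {X : Mat k} {Y : Mat m} (hX : X.IsHermitian) (hY : Y.IsHermitian) :
    (X ⊗ₖ Y).IsHermitian := by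
  rw [IsHermitian, conjTranspose_kronecker, hX.eq, hY.eq]

theorem trace_sum_smul_kronecker_mul_kronecker {ι : Type*} [Fintype ι] (c : ι → ℂ) (γ : ι → Mat k)
    (δ : ι → Mat m) (X : Mat k) (Y : Mat m) :
    ((∑ i, c i • (γ i ⊗ₖ δ i)) * (X ⊗ₖ Y)).trace =
      ∑ i, c i * ((γ i * X).trace * (δ i * Y).trace) := by
  simp only [Matrix.sum_mul, Matrix.smul_mul, trace_sum, trace_smul,
    trace_kronecker_mul_kronecker, smul_eq_mul]

theorem partialTranspose_zero : partialTranspose (0 : BiMat k m) = 0 := rfl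

theorem partialTranspose_add (A B : BiMat k m) :
    partialTranspose (A + B) = partialTranspose A + partialTranspose B := rfl

theorem partialTranspose_kronecker (X : Mat k) (Y : Mat m) :
    partialTranspose (X ⊗ₖ Y) = Xᵀ ⊗ₖ Y := rfl

theorem partialTranspose_partialTranspose (A : BiMat k m) :
    partialTranspose (partialTranspose A) = A := rfl

theorem partialTranspose_kronecker_mul_mul_kronecker (A : BiMat k m) (P R : Mat k) (Q S : Mat m) :
    partialTranspose ((P ⊗ₖ Q) * A * (R ⊗ₖ S)) = (Rᵀ ⊗ₖ Q) * partialTranspose A * (Pᵀ ⊗ₖ S) := by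
  induction A using BiMat.kronecker_induction with
  | zero => simp only [partialTranspose_zero, Matrix.mul_zero, Matrix.zero_mul]
  | add A B hA hB => simp only [Matrix.mul_add, Matrix.add_mul, partialTranspose_add, hA, hB]
  | kronecker X Y =>
    simp only [← mul_kronecker_mul, partialTranspose_kronecker, transpose_mul, Matrix.mul_assoc]

theorem trace_partialTranspose_mul_kronecker (A : BiMat k m) (X : Mat k) (Y : Mat m) :
    (partialTranspose A * (X ⊗ₖ Y)).trace = (A * (Xᵀ ⊗ₖ Y)).trace := by
  induction A using BiMat.kronecker_induction with
  | zero => simp only [partialTranspose_zero, Matrix.zero_mul]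
  | add A B hA hB => simp only [Matrix.add_mul, partialTranspose_add, trace_add, hA, hB]
  | kronecker Z T =>
    rw [partialTranspose_kronecker, trace_kronecker_mul_kronecker, trace_kronecker_mul_kronecker,
      ← trace_transpose (Zᵀ * X), transpose_mul, transpose_transpose, trace_mul_comm]

end Kronecker

section Projection

variable {k : ℕ}

namespace IsHermitianProjection

variable {P Q : Mat k}

theorem posSemidef (hP : IsHermitianProjection P) : P.PosSemidef := by
  simpa only [hP.1.eq, hP.2] using posSemidef_conjTranspose_mul_self P

theorem one_sub (hP : IsHermitianProjection P) : IsHermitianProjection (1 - P) :=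
  ⟨isHermitian_one.sub hP.1, IsIdempotentElem.one_sub hP.2⟩

theorem transpose (hP : IsHermitianProjection P) : IsHermitianProjection Pᵀ :=
  ⟨hP.1.transpose, by rw [← transpose_mul, hP.2]⟩

end IsHermitianProjection

theorem exists_isHermitianProjectionOnto (S : Submodule ℂ (Fin k → ℂ)) :
    ∃ P : Mat k, IsHermitianProjectionOnto P S := by
  let U : Submodule ℂ (EuclideanSpace ℂ (Fin k)) :=
    S.comap (WithLp.linearEquiv 2 ℂ (Fin k → ℂ)).toLinearMap
  let P : Mat k := (toEuclideanCLM (n := Fin k) (𝕜 := ℂ)).symm U.starProjection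
  have mulVec_eq (x : Fin k → ℂ) : P *ᵥ x = (U.starProjection (WithLp.toLp 2 x)).ofLp := by
    rw [← ofLp_toEuclideanCLM, StarAlgEquiv.apply_symm_apply]
  refine ⟨P, ⟨?_, ?_⟩, ?_⟩
  · rw [isHermitian_iff_isSelfAdjoint]
    exact (toEuclideanCLM.symm.map_star' _).symm.trans
      (congrArg _ (isSelfAdjoint_starProjection U).star_eq)
  · exact U.isIdempotentElem_starProjection.map _
  · refine Set.Subset.antisymm (Set.range_subset_iff.mpr fun x => ?_) fun x hx => ⟨x, ?_⟩
    · rw [mulVec_eq]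
      exact U.starProjection_apply_mem _
    · rw [mulVec_eq, Submodule.starProjection_eq_self_iff.mpr (show WithLp.toLp 2 x ∈ U from hx)]

theorem exists_isHermitianProjectionOnto_range (X : Mat k) :
    ∃ V : Mat k, IsHermitianProjectionOnto V (Set.range X.mulVec) := by
  simpa only [LinearMap.coe_range, coe_mulVecLin] using
    exists_isHermitianProjectionOnto (LinearMap.range X.mulVecLin)

namespace IsHermitianProjectionOnto

variable {P ε : Mat k}

theorem mul_eq_self_iff {S : Set (Fin k → ℂ)} (hP : IsHermitianProjectionOnto P S) {M : Mat k} :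
    P * M = M ↔ ∀ x, M *ᵥ x ∈ S := by
  simp only [← hP.2, ext_iff_mulVec, ← mulVec_mulVec]
  refine forall_congr' fun x => ⟨fun h => ⟨_, h⟩, ?_⟩
  rintro ⟨y, hy⟩
  rw [← hy, mulVec_mulVec, hP.1.2]

theorem mul_range_self (hP : IsHermitianProjectionOnto P (Set.range ε.mulVec)) : P * ε = ε :=
  hP.mul_eq_self_iff.mpr fun x => ⟨x, rfl⟩

theorem exists_eq_range_mul (hP : IsHermitianProjectionOnto P (Set.range ε.mulVec)) :
    ∃ Z, P = ε * Z := by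
  have mem_range (i : Fin k) : ∃ y, ε *ᵥ y = P.col i := by
    rw [← Set.mem_range, ← hP.2]
    exact ⟨Pi.single i 1, mulVec_single_one P i⟩
  choose y hy using mem_range
  exact ⟨(of y)ᵀ, ext_col fun i => (hy i).symm⟩

theorem mul_eq_zero_iff (hP : IsHermitianProjectionOnto P (Set.range ε.mulVec))
    (hε : ε.IsHermitian) {M : Mat k} : P * M = 0 ↔ ε * M = 0 := by
  obtain ⟨Z, hZ⟩ := hP.exists_eq_range_mul
  constructor <;> intro h
  · have mul_eq : ε * P = ε := by
      simpa only [conjTranspose_mul, hε.eq, hP.1.1.eq] using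
        congrArg conjTranspose hP.mul_range_self
    rw [← mul_eq, Matrix.mul_assoc, h, Matrix.mul_zero]
  · rw [← hP.1.1.eq, hZ, conjTranspose_mul, hε.eq, Matrix.mul_assoc, h, Matrix.mul_zero]

end IsHermitianProjectionOnto

/-- A resolution of the identity by mutually annihilating Hermitian projections: the
block structures of matrices in one tensor factor. -/
structure IsOrthogonalResolution {ι : Type*} [Fintype ι] (V : ι → Mat k) : Prop where
  projection : ∀ i, IsHermitianProjection (V i)
  mul_eq_zero : ∀ i j, i ≠ j → V i * V j = 0
  sum_eq_one : ∑ i, V i = 1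

theorem IsHermitianProjection.isOrthogonalResolution {P : Mat k} (hP : IsHermitianProjection P) :
    IsOrthogonalResolution ![P, 1 - P] where
  projection := Fin.forall_fin_two.mpr ⟨hP, hP.one_sub⟩
  mul_eq_zero := by
    simp only [Fin.forall_fin_two, cons_val_zero, cons_val_one, Matrix.mul_sub, Matrix.sub_mul,
      Matrix.mul_one, Matrix.one_mul, hP.2, sub_self, ne_eq, not_true_eq_false, zero_ne_one,
      one_ne_zero, implies_true, IsEmpty.forall_iff, and_self]
  sum_eq_one := by
    simp only [Fin.sum_univ_two, cons_val_zero, cons_val_one, add_sub_cancel]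

theorem exists_isProjectionSystem {s : ℕ} (ε : Fin s → Mat k) :
    ∃ V, IsProjectionSystem ε V := by
  choose P hP using fun i => exists_isHermitianProjectionOnto_range (ε i)
  let S : Submodule ℂ (Fin k → ℂ) :=
    { carrier := {x | ∀ (i : Fin s) (y : Fin k → ℂ), star ((ε i).mulVec y) ⬝ᵥ x = 0}
      zero_mem' := fun _ _ => dotProduct_zero _
      add_mem' := fun ha hb i y => by rw [dotProduct_add, ha, hb, add_zero]
      smul_mem' := fun c x hx i y => by rw [dotProduct_smul, hx, smul_zero] }
  obtain ⟨L, hL⟩ := exists_isHermitianProjectionOnto S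
  refine ⟨Fin.snoc P L, fun i => ?_, ?_⟩
  · simpa only [Fin.snoc_castSucc] using hP i
  · rw [Fin.snoc_last]
    exact hL

namespace IsProjectionSystem

variable {s : ℕ} {ε : Fin s → Mat k} {V : Fin (s + 1) → Mat k}

theorem last_mul_eq_self_iff (hV : IsProjectionSystem ε V) {M : Mat k} :
    V (Fin.last s) * M = M ↔ ∀ i, (ε i)ᴴ * M = 0 := by
  have mem_iff (i : Fin s) (x : Fin k → ℂ) :
      (∀ y, star ((ε i).mulVec y) ⬝ᵥ x = 0) ↔ ((ε i)ᴴ) *ᵥ x = 0 := by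
    simp only [star_mulVec, ← dotProduct_mulVec]
    exact ⟨fun h => dotProduct_eq_zero _ fun y => by rw [dotProduct_comm, ← star_star y, h],
      fun h y => by rw [h, dotProduct_zero]⟩
  simp only [hV.2.mul_eq_self_iff, Set.mem_ofPred_eq, mem_iff, ext_iff_mulVec, zero_mulVec,
    ← mulVec_mulVec]
  exact forall_comm

theorem isOrthogonalResolution (hV : IsProjectionSystem ε V) (hε : ∀ i, (ε i).IsHermitian)
    (orthogonal : ∀ i j, i ≠ j → ε i * ε j = 0) : IsOrthogonalResolution V := by
  have castSucc_mul_eq_zero_iff (i : Fin s) {M : Mat k} : V i.castSucc * M = 0 ↔ ε i * M = 0 :=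
    (hV.1 i).mul_eq_zero_iff (hε i)
  have mul_castSucc (i j : Fin s) (hij : i ≠ j) : V i.castSucc * V j.castSucc = 0 := by
    rw [castSucc_mul_eq_zero_iff, mul_eq_zero_comm_of_isHermitian (hε i) (hV.1 j).1.1,
      castSucc_mul_eq_zero_iff]
    exact orthogonal j i hij.symm
  have mul_last (i : Fin s) : V i.castSucc * V (Fin.last s) = 0 := by
    rw [castSucc_mul_eq_zero_iff, ← (hε i).eq]
    exact hV.last_mul_eq_self_iff.mp hV.2.1.2 i
  have last_mul (i : Fin s) : V (Fin.last s) * V i.castSucc = 0 :=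
    (mul_eq_zero_comm_of_isHermitian (hV.1 i).1.1 hV.2.1.1).mp (mul_last i)
  refine ⟨Fin.lastCases hV.2.1 fun i => (hV.1 i).1, fun i j hij => ?_, ?_⟩
  · induction i using Fin.lastCases with
    | last => induction j using Fin.lastCases with
      | last => exact absurd rfl hij
      | cast j => exact last_mul j
    | cast i => induction j using Fin.lastCases with
      | last => exact mul_last i
      | cast j => exact mul_castSucc i j (ne_of_apply_ne _ hij)
  · have annihilated (i : Fin s) : (ε i)ᴴ * (1 - ∑ j : Fin s, V j.castSucc) = 0 := by
      rw [(hε i).eq, ← castSucc_mul_eq_zero_iff, Matrix.mul_sub, Matrix.mul_one, Matrix.mul_sum,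
        Finset.sum_eq_single_of_mem i (Finset.mem_univ i) fun j _ hj => mul_castSucc i j hj.symm,
        (hV.1 i).1.2, sub_self]
    have last_mul_complement := hV.last_mul_eq_self_iff.mpr annihilated
    rw [Matrix.mul_sub, Matrix.mul_one, Matrix.mul_sum, Finset.sum_eq_zero fun i _ => last_mul i,
      sub_zero] at last_mul_complement
    rw [Fin.sum_univ_castSucc, last_mul_complement, add_sub_cancel]

end IsProjectionSystem

end Projection

section Compress

variable {k m : ℕ}

theorem compress_zero (V : Mat k) (W : Mat m) : compress V W 0 = 0 := by
  rw [compress, Matrix.mul_zero, Matrix.zero_mul]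

theorem compress_sum {ι : Type*} (s : Finset ι) (V : Mat k) (W : Mat m) (A : ι → BiMat k m) :
    compress V W (∑ i ∈ s, A i) = ∑ i ∈ s, compress V W (A i) := by
  simp only [compress, Matrix.mul_sum, Matrix.sum_mul]

theorem compress_kronecker (V : Mat k) (W : Mat m) (X : Mat k) (Y : Mat m) :
    compress V W (X ⊗ₖ Y) = (V * X * V) ⊗ₖ (W * Y * W) := by
  simp only [compress, ← mul_kronecker_mul]

theorem posSemidef_compress {A : BiMat k m} (hA : A.PosSemidef) {V : Mat k} {W : Mat m}
    (hV : V.IsHermitian) (hW : W.IsHermitian) : (compress V W A).PosSemidef := by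
  simpa only [compress, (isHermitian_kronecker hV hW).eq] using
    hA.mul_mul_conjTranspose_same (V ⊗ₖ W)

theorem IsPPT.compress {A : BiMat k m} (hA : IsPPT A) {V : Mat k} {W : Mat m}
    (hV : V.IsHermitian) (hW : W.IsHermitian) : IsPPT (compress V W A) := by
  refine ⟨posSemidef_compress hA.1 hV hW, ?_⟩
  rw [_root_.compress, partialTranspose_kronecker_mul_mul_kronecker]
  exact posSemidef_compress hA.2 hV.transpose hW

theorem IsSeparableMatrix.compress {A : BiMat k m} (hA : IsSeparableMatrix A) {V : Mat k}
    {W : Mat m} (hV : V.IsHermitian) (hW : W.IsHermitian) :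
    IsSeparableMatrix (compress V W A) := by
  obtain ⟨n, C, D, hC, hD, rfl⟩ := hA
  refine ⟨n, fun i => V * C i * V, fun i => W * D i * W, fun i => ?_, fun i => ?_, ?_⟩
  · simpa only [hV.eq] using (hC i).mul_mul_conjTranspose_same V
  · simpa only [hW.eq] using (hD i).mul_mul_conjTranspose_same W
  · simp only [compress_sum, compress_kronecker]

theorem isSeparableMatrix_sum {ι : Type*} [Fintype ι] {T : ι → BiMat k m}
    (h : ∀ i, IsSeparableMatrix (T i)) : IsSeparableMatrix (∑ i, T i) := by
  choose n C D hC hD hT using h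
  let e := Fintype.equivFin ((i : ι) × Fin (n i))
  refine ⟨_, fun a => C _ (e.symm a).2, fun a => D _ (e.symm a).2, fun a => hC _ _,
    fun a => hD _ _, ?_⟩
  rw [e.symm.sum_comp fun p => C p.1 p.2 ⊗ₖ D p.1 p.2, Fintype.sum_sigma]
  exact Finset.sum_congr rfl fun i _ => hT i

end Compress

section BlockDecomposition

variable {k m : ℕ} {ι : Type*} [Fintype ι]

/-- `A` is block diagonal: it is the sum of its compressions to the blocks `V i ⊗ W i` of
orthogonal resolutions of the identity in the two tensor factors. -/
structure IsBlockDecomposition (A : BiMat k m) (V : ι → Mat k) (W : ι → Mat m) : Prop where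
  left : IsOrthogonalResolution V
  right : IsOrthogonalResolution W
  eq_sum : A = ∑ i, compress (V i) (W i) A

namespace IsBlockDecomposition

variable {A : BiMat k m} {V : ι → Mat k} {W : ι → Mat m}

theorem of_mul_kronecker_eq_zero (hV : IsOrthogonalResolution V) (hW : IsOrthogonalResolution W)
    (hA : A.IsHermitian) (mixed : ∀ i j, i ≠ j → A * (V i ⊗ₖ W j) = 0)
    (off_diagonal : ∀ i j, i ≠ j → (V i ⊗ₖ W i) * A * (V j ⊗ₖ W j) = 0) :
    IsBlockDecomposition A V W := by
  refine ⟨hV, hW, ?_⟩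
  let Q := ∑ i, V i ⊗ₖ W i
  have isHermitian_Q : Q.IsHermitian := isHermitian_sum _ fun i _ =>
    isHermitian_kronecker (hV.projection i).1 (hW.projection i).1
  have mul_Q : A * Q = A :=
    calc A * Q = ∑ i, ∑ j, A * (V i ⊗ₖ W j) := by
          rw [Matrix.mul_sum]
          exact Finset.sum_congr rfl fun i _ => (Finset.sum_eq_single_of_mem i
            (Finset.mem_univ i) fun j _ hj => mixed i j hj.symm).symm
      _ = A := by
          simp only [← Matrix.mul_sum, ← kronecker_sum, ← sum_kronecker, hV.sum_eq_one,
            hW.sum_eq_one, one_kronecker_one, Matrix.mul_one]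
  have Q_mul : Q * A = A := by
    simpa only [conjTranspose_mul, hA.eq, isHermitian_Q.eq] using congrArg conjTranspose mul_Q
  calc A = Q * A * Q := by rw [Q_mul, mul_Q]
    _ = ∑ i, ∑ j, (V i ⊗ₖ W i) * A * (V j ⊗ₖ W j) := by
        simp only [Q, Matrix.mul_sum, Matrix.sum_mul]
        exact Finset.sum_comm
    _ = ∑ i, compress (V i) (W i) A := Finset.sum_congr rfl fun i _ =>
        Finset.sum_eq_single_of_mem i (Finset.mem_univ i) fun j _ hj => off_diagonal i j hj.symm

theorem mul_kronecker_one (h : IsBlockDecomposition A V W) (i : ι) :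
    A * (V i ⊗ₖ 1) = compress (V i) (W i) A := by
  conv_lhs => rw [h.eq_sum, Matrix.sum_mul]
  rw [Finset.sum_eq_single_of_mem i (Finset.mem_univ i) fun j _ hj => ?_] <;>
    rw [compress, Matrix.mul_assoc _ (_ ⊗ₖ _) (_ ⊗ₖ _), ← mul_kronecker_mul, Matrix.mul_one]
  · rw [(h.left.projection i).2]
  · rw [h.left.mul_eq_zero j i hj, zero_kronecker, Matrix.mul_zero]

theorem mul_one_kronecker (h : IsBlockDecomposition A V W) (i : ι) :
    A * (1 ⊗ₖ W i) = compress (V i) (W i) A := by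
  conv_lhs => rw [h.eq_sum, Matrix.sum_mul]
  rw [Finset.sum_eq_single_of_mem i (Finset.mem_univ i) fun j _ hj => ?_] <;>
    rw [compress, Matrix.mul_assoc _ (_ ⊗ₖ _) (_ ⊗ₖ _), ← mul_kronecker_mul, Matrix.mul_one]
  · rw [(h.right.projection i).2]
  · rw [h.right.mul_eq_zero j i hj, kronecker_zero, Matrix.mul_zero]

theorem kronecker_one_mul (h : IsBlockDecomposition A V W) (i : ι) :
    (V i ⊗ₖ 1) * A = compress (V i) (W i) A := by
  conv_lhs => rw [h.eq_sum, Matrix.mul_sum]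
  rw [Finset.sum_eq_single_of_mem i (Finset.mem_univ i) fun j _ hj => ?_] <;>
    rw [compress, ← Matrix.mul_assoc, ← Matrix.mul_assoc, ← mul_kronecker_mul, Matrix.one_mul]
  · rw [(h.left.projection i).2]
  · rw [h.left.mul_eq_zero i j hj.symm, zero_kronecker, Matrix.zero_mul, Matrix.zero_mul]

theorem one_kronecker_mul (h : IsBlockDecomposition A V W) (i : ι) :
    (1 ⊗ₖ W i) * A = compress (V i) (W i) A := by
  conv_lhs => rw [h.eq_sum, Matrix.mul_sum]
  rw [Finset.sum_eq_single_of_mem i (Finset.mem_univ i) fun j _ hj => ?_] <;>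
    rw [compress, ← Matrix.mul_assoc, ← Matrix.mul_assoc, ← mul_kronecker_mul, Matrix.one_mul]
  · rw [(h.right.projection i).2]
  · rw [h.right.mul_eq_zero i j hj.symm, kronecker_zero, Matrix.zero_mul, Matrix.zero_mul]

theorem mul_kronecker_eq_zero (h : IsBlockDecomposition A V W) {i j : ι} (hij : i ≠ j) :
    A * (V i ⊗ₖ W j) = 0 := by
  rw [← Matrix.mul_one (V i), ← Matrix.one_mul (W j), mul_kronecker_mul, ← Matrix.mul_assoc,
    h.mul_kronecker_one, compress, Matrix.mul_assoc _ (_ ⊗ₖ _) (_ ⊗ₖ _), ← mul_kronecker_mul,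
    h.right.mul_eq_zero i j hij, kronecker_zero, Matrix.mul_zero]

theorem isSeparableMatrix_iff (h : IsBlockDecomposition A V W) :
    IsSeparableMatrix A ↔ ∀ i, IsSeparableMatrix (compress (V i) (W i) A) := by
  refine ⟨fun hA i => hA.compress (h.left.projection i).1 (h.right.projection i).1, fun hA => ?_⟩
  rw [h.eq_sum]
  exact isSeparableMatrix_sum hA

end IsBlockDecomposition

theorem IsPPT.isBlockDecomposition {A : BiMat k m} (hA : IsPPT A) {V : ι → Mat k} {W : ι → Mat m}
    (hV : IsOrthogonalResolution V) (hW : IsOrthogonalResolution W)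
    (mixed : ∀ i j, i ≠ j → A * (V i ⊗ₖ W j) = 0) : IsBlockDecomposition A V W := by
  refine .of_mul_kronecker_eq_zero hV hW hA.1.isHermitian mixed fun i j hij => ?_
  have partialTranspose_mul : partialTranspose A * ((V i)ᵀ ⊗ₖ W j) = 0 := by
    refine mul_eq_zero_of_posSemidef_of_trace_mul_eq_zero hA.2
      ((hV.projection i).transpose.posSemidef.kronecker (hW.projection j).posSemidef) ?_
    rw [trace_partialTranspose_mul_kronecker, transpose_transpose, mixed i j hij, trace_zero]
  rw [← partialTranspose_partialTranspose ((V i ⊗ₖ W i) * A * (V j ⊗ₖ W j)),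
    partialTranspose_kronecker_mul_mul_kronecker, Matrix.mul_assoc, partialTranspose_mul,
    Matrix.mul_zero, partialTranspose_zero]

theorem trace_mul_eq_zero_of_trace_mul_kronecker_conjTranspose_eq_zero {ι : Type} [Fintype ι]
    [DecidableEq ι] {A : BiMat k k} {c : ι → ℝ} {γ : ι → Mat k}
    (hA : IsHermitianSchmidtDecomposition A c γ γ) {X : Mat k} (h : (A * (X ⊗ₖ Xᴴ)).trace = 0)
    (i : ι) : (γ i * X).trace = 0 := by
  have trace_conjTranspose_eq (j : ι) : (γ j * Xᴴ).trace = star (γ j * X).trace := by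
    rw [← trace_conjTranspose, conjTranspose_mul, (hA.left_hermitian j).eq, trace_mul_comm]
  rw [hA.eq_sum, trace_sum_smul_kronecker_mul_kronecker] at h
  simp only [trace_conjTranspose_eq] at h
  have term_eq_zero := (Finset.sum_eq_zero_iff_of_nonneg fun j _ => mul_nonneg
    (Complex.zero_le_real.mpr (hA.pos j).le) (mul_star_self_nonneg _)).mp h i (Finset.mem_univ i)
  simpa only [mul_eq_zero, Complex.ofReal_eq_zero, (hA.pos i).ne', star_eq_zero, or_self,
    false_or] using term_eq_zero

theorem IsSPC.isBlockDecomposition {A : BiMat k k} (hA : IsSPC A) {V : ι → Mat k}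
    (hV : IsOrthogonalResolution V) (mixed : ∀ i j, i ≠ j → A * (V i ⊗ₖ V j) = 0) :
    IsBlockDecomposition A V V := by
  refine .of_mul_kronecker_eq_zero hV hV hA.1.isHermitian mixed fun i j hij => ?_
  obtain ⟨-, n, c, γ, hγ⟩ := hA
  have mul_mul_eq_zero (l : Fin n) : V i * γ l * V j = 0 := by
    refine Matrix.ext_iff_trace_mul_right.mpr fun Z => ?_
    have annihilated : A * ((V j * Z * V i) ⊗ₖ (V j * Z * V i)ᴴ) = 0 := by
      rw [conjTranspose_mul, conjTranspose_mul, (hV.projection i).1.eq, (hV.projection j).1.eq,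
        Matrix.mul_assoc, mul_kronecker_mul, ← Matrix.mul_assoc, mixed j i hij.symm,
        Matrix.zero_mul]
    rw [Matrix.mul_assoc, Matrix.mul_assoc, trace_mul_comm, Matrix.mul_assoc, Matrix.zero_mul,
      trace_zero]
    exact trace_mul_eq_zero_of_trace_mul_kronecker_conjTranspose_eq_zero hγ
      (by rw [annihilated, trace_zero]) l
  simp only [hγ.eq_sum, Matrix.mul_sum, Matrix.sum_mul, Matrix.mul_smul, Matrix.smul_mul,
    ← mul_kronecker_mul, mul_mul_eq_zero, zero_kronecker, smul_zero, Finset.sum_const_zero]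

end BlockDecomposition

section TensorRank

variable {k m : ℕ} {ι : Type*} [Fintype ι]

open Classical in
theorem exists_sum_kronecker_ne_zero (C : ι → Mat k) (D : ι → Mat m) :
    ∃ (C' : Fin (Fintype.card {i // C i ⊗ₖ D i ≠ 0}) → Mat k) (D' : Fin _ → Mat m),
      (∀ i, C' i ⊗ₖ D' i ≠ 0) ∧ ∑ i, C i ⊗ₖ D i = ∑ i, C' i ⊗ₖ D' i := by
  let e := Fintype.equivFin {i // C i ⊗ₖ D i ≠ 0}
  refine ⟨fun i => C (e.symm i), fun i => D (e.symm i), fun i => (e.symm i).2, ?_⟩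
  rw [e.symm.sum_comp fun i => C i ⊗ₖ D i,
    ← Fintype.sum_subtype_add_sum_subtype fun i => C i ⊗ₖ D i ≠ 0]
  exact add_eq_left.mpr (Finset.sum_eq_zero fun i _ => not_not.mp i.2)

open Classical in
theorem tensorRank_sum_le (C : ι → Mat k) (D : ι → Mat m) :
    tensorRank (∑ i, C i ⊗ₖ D i) ≤ Fintype.card {i // C i ⊗ₖ D i ≠ 0} :=
  Nat.sInf_le (exists_sum_kronecker_ne_zero C D)

theorem BiMat.exists_eq_sum_kronecker (A : BiMat k m) :
    ∃ (n : ℕ) (C : Fin n → Mat k) (D : Fin n → Mat m), A = ∑ i, C i ⊗ₖ D i := by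
  induction A using BiMat.kronecker_induction with
  | zero => exact ⟨0, 0, 0, rfl⟩
  | kronecker X Y => exact ⟨1, fun _ => X, fun _ => Y, by rw [Fin.sum_univ_one]⟩
  | add A B hA hB =>
    obtain ⟨n, C, D, rfl⟩ := hA
    obtain ⟨n', C', D', rfl⟩ := hB
    refine ⟨n + n', Fin.append C C', Fin.append D D', ?_⟩
    simp only [Fin.sum_univ_add, Fin.append_left, Fin.append_right]

theorem exists_eq_sum_kronecker_tensorRank (A : BiMat k m) :
    ∃ (C : Fin (tensorRank A) → Mat k) (D : Fin (tensorRank A) → Mat m),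
      A = ∑ i, C i ⊗ₖ D i := by
  obtain ⟨C, D, -, hCD⟩ := Nat.sInf_mem (s := {n : ℕ | ∃ (C : Fin n → Mat k) (D : Fin n → Mat m),
      (∀ i, C i ⊗ₖ D i ≠ 0) ∧ A = ∑ i, C i ⊗ₖ D i}) <| by
    obtain ⟨n, C, D, rfl⟩ := BiMat.exists_eq_sum_kronecker A
    exact ⟨_, exists_sum_kronecker_ne_zero C D⟩
  exact ⟨C, D, hCD⟩

theorem tensorRank_sum_lt_of_not_linearIndependent {C : ι → Mat k} (D : ι → Mat m)
    (hC : ¬ LinearIndependent ℂ C) : tensorRank (∑ i, C i ⊗ₖ D i) < Fintype.card ι := by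
  classical
  obtain ⟨g, hg, l, hl⟩ := Fintype.not_linearIndependent_iff.mp hC
  let D' : ι → Mat m := fun i => D i - ((g l)⁻¹ * g i) • D l
  have sum_eq : ∑ i, C i ⊗ₖ D i = ∑ i, C i ⊗ₖ D' i := by
    have correction : ∑ i, C i ⊗ₖ (((g l)⁻¹ * g i) • D l) = 0 := by
      simp only [kronecker_smul, ← smul_kronecker, ← sum_kronecker]
      simp only [mul_smul, ← Finset.smul_sum, hg, smul_zero, zero_kronecker]
    simp only [D', kronecker_sub, Finset.sum_sub_distrib, correction, sub_zero]
  have kronecker_eq_zero : C l ⊗ₖ D' l = 0 := by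
    simp only [D', inv_mul_cancel₀ hl, one_smul, sub_self, kronecker_zero]
  rw [sum_eq]
  exact (tensorRank_sum_le C D').trans_lt
    (Fintype.card_subtype_lt (x := l) (not_not.mpr kronecker_eq_zero))

theorem eq_zero_of_linearIndependent_of_sum_kronecker_eq_zero {C : ι → Mat k} {D : ι → Mat m}
    (hC : LinearIndependent ℂ C) (h : ∑ i, C i ⊗ₖ D i = 0) (i : ι) : D i = 0 := by
  ext p q
  refine Fintype.linearIndependent_iff.mp hC (fun j => D j p q) ?_ i
  ext a b
  have entry_eq := congrFun₂ h (a, p) (b, q)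
  simp only [Matrix.sum_apply, kronecker_apply, Matrix.zero_apply] at entry_eq
  simpa only [Matrix.sum_apply, Matrix.smul_apply, smul_eq_mul, mul_comm, Matrix.zero_apply]
    using entry_eq

-- The mixed block `(i, j)` vanishes and the block `j` does not, so the compressions `V i C V i`
-- of the left factors of a shortest representation of `A` cannot be linearly independent.
theorem IsBlockDecomposition.tensorRank_compress_lt {A : BiMat k m} {V : ι → Mat k}
    {W : ι → Mat m} (h : IsBlockDecomposition A V W) {i j : ι} (hij : i ≠ j)
    (hj : compress (V j) (W j) A ≠ 0) :
    tensorRank (compress (V i) (W i) A) < tensorRank A := by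
  obtain ⟨C, D, hA⟩ := exists_eq_sum_kronecker_tensorRank A
  have compress_eq_sum (a b : ι) : compress (V a) (W b) A =
      ∑ l, (V a * C l * V a) ⊗ₖ (W b * D l * W b) := by
    conv_lhs => rw [hA]
    simp only [compress_sum, compress_kronecker]
  have mixed : ∑ l, (V i * C l * V i) ⊗ₖ (W j * D l * W j) = 0 := by
    rw [← compress_eq_sum, compress, Matrix.mul_assoc, h.mul_kronecker_eq_zero hij,
      Matrix.mul_zero]
  have dependent : ¬ LinearIndependent ℂ fun l => V i * C l * V i := by
    intro independent
    refine hj ?_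
    simp only [compress_eq_sum,
      eq_zero_of_linearIndependent_of_sum_kronecker_eq_zero independent mixed, kronecker_zero,
      Finset.sum_const_zero]
  rw [compress_eq_sum]
  exact (tensorRank_sum_lt_of_not_linearIndependent _ dependent).trans_eq (Fintype.card_fin _)

end TensorRank

section SingularPair

variable {k m : ℕ}

/-- `(X, Y)` is a pair of Hermitian singular vectors, with singular value `μ`, of the bilinear form
`(X, Y) ↦ tr (A (X ⊗ Y))`. -/
structure IsSingularPair (A : BiMat k m) (μ : ℝ) (X : Mat k) (Y : Mat m) : Prop where
  left_hermitian : X.IsHermitian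
  right_hermitian : Y.IsHermitian
  trace_left : ∀ Z, (A * (X ⊗ₖ Z)).trace = μ * (Y * Z).trace
  trace_right : ∀ Z, (A * (Z ⊗ₖ Y)).trace = μ * (X * Z).trace

/-- The real vector space of pairs of singular vectors of `A` with singular value `μ`. -/
def singularPairs (A : BiMat k m) (μ : ℝ) : Submodule ℝ (Mat k × Mat m) where
  carrier := {p | IsSingularPair A μ p.1 p.2}
  zero_mem' := ⟨isHermitian_zero, isHermitian_zero,
    fun Z => by simp only [Prod.fst_zero, Prod.snd_zero, zero_kronecker, Matrix.zero_mul,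
      trace_zero, mul_zero],
    fun Z => by simp only [Prod.fst_zero, Prod.snd_zero, kronecker_zero, Matrix.zero_mul,
      trace_zero, mul_zero]⟩
  add_mem' hp hq := ⟨hp.1.add hq.1, hp.2.add hq.2,
    fun Z => by simp only [Prod.fst_add, Prod.snd_add, add_kronecker, Matrix.add_mul,
      trace_add, hp.trace_left, hq.trace_left, mul_add],
    fun Z => by simp only [Prod.fst_add, Prod.snd_add, kronecker_add, Matrix.add_mul,
      trace_add, hp.trace_right, hq.trace_right, mul_add]⟩
  smul_mem' r p hp := ⟨hp.1.smul (.all r), hp.2.smul (.all r),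
    fun Z => by simp only [Prod.smul_fst, Prod.smul_snd, smul_kronecker, Matrix.smul_mul,
      trace_smul, hp.trace_left, mul_smul_comm],
    fun Z => by simp only [Prod.smul_fst, Prod.smul_snd, kronecker_smul, Matrix.smul_mul,
      trace_smul, hp.trace_right, mul_smul_comm]⟩

/-- The left singular vectors of `A` with singular value `μ`. -/
noncomputable def singularSpace (A : BiMat k m) (μ : ℝ) : Submodule ℝ (Mat k) :=
  (singularPairs A μ).map (LinearMap.fst ℝ (Mat k) (Mat m))

theorem mem_singularSpace {A : BiMat k m} {μ : ℝ} {X : Mat k} :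
    X ∈ singularSpace A μ ↔ ∃ Y, IsSingularPair A μ X Y :=
  ⟨fun ⟨p, hp, hX⟩ => ⟨p.2, hX ▸ hp⟩, fun ⟨Y, hY⟩ => ⟨(X, Y), hY, rfl⟩⟩

namespace IsSingularPair

variable {A : BiMat k m} {μ ν : ℝ} {X X' : Mat k} {Y Y' : Mat m}

theorem sum_smul {ι : Type*} [Fintype ι] {X : ι → Mat k} {Y : ι → Mat m}
    (h : ∀ i, IsSingularPair A μ (X i) (Y i)) (x : ι → ℝ) :
    IsSingularPair A μ (∑ i, x i • X i) (∑ i, x i • Y i) := by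
  have mem : ∑ i, x i • (X i, Y i) ∈ singularPairs A μ :=
    Submodule.sum_mem _ fun i _ => Submodule.smul_mem _ _ (h i)
  simp only [Prod.smul_mk, ← prod_mk_sum] at mem
  exact mem

theorem right_unique (hμ : μ ≠ 0) (h : IsSingularPair A μ X Y) (h' : IsSingularPair A μ X Y') :
    Y = Y' :=
  Matrix.ext_iff_trace_mul_right.mpr fun Z => mul_left_cancel₀ (Complex.ofReal_ne_zero.mpr hμ)
    ((h.trace_left Z).symm.trans (h'.trace_left Z))

theorem trace_mul_right_eq (hμ : μ ≠ 0) (h : IsSingularPair A μ X Y)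
    (h' : IsSingularPair A μ X' Y') : (Y * Y').trace = (X * X').trace := by
  refine mul_left_cancel₀ (Complex.ofReal_ne_zero.mpr hμ) ?_
  rw [← h.trace_left, h'.trace_right, trace_mul_comm]

theorem trace_mul_eq_zero (h : IsSingularPair A μ X Y) (h' : IsSingularPair A ν X' Y')
    (hμν : μ ^ 2 ≠ ν ^ 2) : (X * X').trace = 0 ∧ (Y * Y').trace = 0 := by
  have left : μ * (Y * Y').trace = ν * (X * X').trace := by
    rw [← h.trace_left, h'.trace_right, trace_mul_comm]
  have right : μ * (X * X').trace = ν * (Y * Y').trace := by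
    rw [← h.trace_right, h'.trace_left, trace_mul_comm]
  have sq_sub_sq_ne_zero : (μ ^ 2 - ν ^ 2 : ℂ) ≠ 0 := by
    exact_mod_cast sub_ne_zero.mpr hμν
  constructor <;> refine (mul_eq_zero.mp ?_).resolve_left sq_sub_sq_ne_zero
  · linear_combination μ * right + ν * left
  · linear_combination μ * left + ν * right

theorem right_posSemidef (hA : A.PosSemidef) (hμ : 0 < μ) (h : IsSingularPair A μ X Y)
    (hX : X.PosSemidef) : Y.PosSemidef := by
  obtain ⟨Q, R, hQ, hR, rfl, hQR⟩ := exists_posSemidef_sub_of_isHermitian h.right_hermitian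
  have trace_eq : (A * (X ⊗ₖ R)).trace = μ * -(R * R).trace := by
    rw [h.trace_left, Matrix.sub_mul, hQR, zero_sub, trace_neg]
  have trace_nonneg := trace_mul_nonneg_of_posSemidef hA (hX.kronecker hR)
  rw [trace_eq, mul_neg, neg_nonneg] at trace_nonneg
  have trace_eq_zero := trace_nonneg.antisymm
    (mul_nonneg (Complex.zero_le_real.mpr hμ.le)
      (trace_mul_self_nonneg_of_isHermitian hR.isHermitian))
  rw [mul_eq_zero, Complex.ofReal_eq_zero, or_iff_right hμ.ne',
    trace_mul_self_eq_zero_iff_of_isHermitian hR.isHermitian] at trace_eq_zero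
  rw [trace_eq_zero, sub_zero]
  exact hQ

theorem mul_kronecker_eq_zero_of_mul_eq_zero (hA : A.PosSemidef) (h : IsSingularPair A μ X Y)
    (hX : X.PosSemidef) {Z : Mat m} (hZ : Z.PosSemidef) (hYZ : Y * Z = 0) :
    A * (X ⊗ₖ Z) = 0 :=
  mul_eq_zero_of_posSemidef_of_trace_mul_eq_zero hA (hX.kronecker hZ) <| by
    rw [h.trace_left, hYZ, trace_zero, mul_zero]

theorem kronecker_mul_eq_zero_of_mul_eq_zero (hA : A.PosSemidef) (h : IsSingularPair A μ X Y)
    (hY : Y.PosSemidef) {Z : Mat k} (hZ : Z.PosSemidef) (hXZ : X * Z = 0) :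
    A * (Z ⊗ₖ Y) = 0 :=
  mul_eq_zero_of_posSemidef_of_trace_mul_eq_zero hA (hZ.kronecker hY) <| by
    rw [h.trace_right, hXZ, trace_zero, mul_zero]

section Block

variable {ι : Type*} [Fintype ι] {V : ι → Mat k} {W : ι → Mat m}

theorem block_mul_left_comm (h : IsSingularPair A μ X Y) (hμ : μ ≠ 0)
    (hA : IsBlockDecomposition A V W) (i : ι) : V i * X = X * V i := by
  refine Matrix.ext_iff_trace_mul_right.mpr fun Z =>
    mul_left_cancel₀ (Complex.ofReal_ne_zero.mpr hμ) ?_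
  calc μ * (V i * X * Z).trace
      = (A * ((Z * V i) ⊗ₖ Y)).trace := by
        rw [h.trace_right, ← Matrix.mul_assoc, trace_mul_comm _ (V i), Matrix.mul_assoc]
    _ = ((V i ⊗ₖ 1) * A * (Z ⊗ₖ Y)).trace := by
        rw [← Matrix.mul_one Y, mul_kronecker_mul, ← Matrix.mul_assoc, trace_mul_comm,
          Matrix.mul_one, Matrix.mul_assoc]
    _ = (A * ((V i * Z) ⊗ₖ Y)).trace := by
        rw [hA.kronecker_one_mul, ← hA.mul_kronecker_one, Matrix.mul_assoc, ← mul_kronecker_mul,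
          Matrix.one_mul]
    _ = μ * (X * V i * Z).trace := by rw [h.trace_right, Matrix.mul_assoc]

theorem block_mul_right_comm (h : IsSingularPair A μ X Y) (hμ : μ ≠ 0)
    (hA : IsBlockDecomposition A V W) (i : ι) : W i * Y = Y * W i := by
  refine Matrix.ext_iff_trace_mul_right.mpr fun Z =>
    mul_left_cancel₀ (Complex.ofReal_ne_zero.mpr hμ) ?_
  calc μ * (W i * Y * Z).trace
      = (A * (X ⊗ₖ (Z * W i))).trace := by
        rw [h.trace_left, ← Matrix.mul_assoc, trace_mul_comm _ (W i), Matrix.mul_assoc]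
    _ = ((1 ⊗ₖ W i) * A * (X ⊗ₖ Z)).trace := by
        rw [← Matrix.mul_one X, mul_kronecker_mul, ← Matrix.mul_assoc, trace_mul_comm,
          Matrix.mul_one, Matrix.mul_assoc]
    _ = (A * (X ⊗ₖ (W i * Z))).trace := by
        rw [hA.one_kronecker_mul, ← hA.mul_one_kronecker, Matrix.mul_assoc, ← mul_kronecker_mul,
          Matrix.one_mul]
    _ = μ * (Y * W i * Z).trace := by rw [h.trace_left, Matrix.mul_assoc]

theorem block_mul (h : IsSingularPair A μ X Y) (hμ : μ ≠ 0)
    (hA : IsBlockDecomposition A V W) (i : ι) : IsSingularPair A μ (V i * X) (W i * Y) where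
  left_hermitian := ((hA.left.projection i).1.commute_iff h.left_hermitian).mp
    (h.block_mul_left_comm hμ hA i)
  right_hermitian := ((hA.right.projection i).1.commute_iff h.right_hermitian).mp
    (h.block_mul_right_comm hμ hA i)
  trace_left Z :=
    calc (A * ((V i * X) ⊗ₖ Z)).trace
        = (A * (X ⊗ₖ (W i * Z))).trace := by
          rw [← Matrix.one_mul Z, mul_kronecker_mul, ← Matrix.mul_assoc, hA.mul_kronecker_one,
            ← hA.mul_one_kronecker, Matrix.mul_assoc, ← mul_kronecker_mul, Matrix.one_mul,
            Matrix.one_mul]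
      _ = μ * (W i * Y * Z).trace := by
          rw [h.trace_left, ← Matrix.mul_assoc, h.block_mul_right_comm hμ hA]
  trace_right Z :=
    calc (A * (Z ⊗ₖ (W i * Y))).trace
        = (A * ((V i * Z) ⊗ₖ Y)).trace := by
          rw [← Matrix.one_mul Z, mul_kronecker_mul, ← Matrix.mul_assoc, hA.mul_one_kronecker,
            ← hA.mul_kronecker_one, Matrix.mul_assoc, ← mul_kronecker_mul, Matrix.one_mul,
            Matrix.one_mul]
      _ = μ * (V i * X * Z).trace := by
          rw [h.trace_right, ← Matrix.mul_assoc, h.block_mul_left_comm hμ hA]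

end Block

end IsSingularPair

end SingularPair

section SingularBound

variable {k m : ℕ}

/-- The bilinear form `(X, Y) ↦ tr (A (X ⊗ Y))` on Hermitian matrices has norm at most `μ`. The
bound `tr (A (X ⊗ Y)) ≤ μ ‖X‖ ‖Y‖` is stated in its equivalent additive form, which is a
quadratic inequality in `(X, Y)`. -/
def IsSingularBound (A : BiMat k m) (μ : ℝ) : Prop :=
  ∀ (X : Mat k) (Y : Mat m), X.IsHermitian → Y.IsHermitian →
    2 * (A * (X ⊗ₖ Y)).trace.re ≤ μ * ((X * X).trace.re + (Y * Y).trace.re)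

theorem exists_eq_isHermitian_add_I_smul {n : Type*} (Z : Matrix n n ℂ) :
    ∃ H K : Matrix n n ℂ, H.IsHermitian ∧ K.IsHermitian ∧ Z = H + Complex.I • K :=
  ⟨realPart Z, imaginaryPart Z, (realPart Z).2, (imaginaryPart Z).2,
    (realPart_add_I_smul_imaginaryPart Z).symm⟩

theorem eq_zero_of_forall_quadratic_nonneg {a b : ℝ} (h : ∀ t : ℝ, 0 ≤ a * (t * t) + b * t) :
    b = 0 := by
  have discrim_nonpos := discrim_le_zero (a := a) (b := b) (c := 0) (by simpa only [add_zero])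
  rw [discrim, mul_zero, sub_zero] at discrim_nonpos
  exact pow_eq_zero_iff two_ne_zero |>.mp (discrim_nonpos.antisymm (sq_nonneg b))

theorem re_trace_add_smul_mul_self {n : Type*} [Fintype n] (X Z : Matrix n n ℂ) (t : ℝ) :
    ((X + t • Z) * (X + t • Z)).trace.re =
      (X * X).trace.re + 2 * t * (X * Z).trace.re + t * t * (Z * Z).trace.re := by
  simp only [Matrix.add_mul, Matrix.mul_add, Matrix.smul_mul, Matrix.mul_smul, trace_add,
    trace_smul, trace_mul_comm Z X, Complex.add_re, Complex.smul_re, smul_eq_mul]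
  ring

variable {A : BiMat k m} {μ : ℝ} {X : Mat k} {Y : Mat m}

-- At a maximiser, the quadratic function obtained by moving one of the two arguments is
-- nonnegative and has no constant term, so its linear term vanishes.
theorem IsSingularBound.isSingularPair (h : IsSingularBound A μ) (hA : A.IsHermitian)
    (hX : X.IsHermitian) (hY : Y.IsHermitian)
    (attained : μ * ((X * X).trace.re + (Y * Y).trace.re) ≤ 2 * (A * (X ⊗ₖ Y)).trace.re) :
    IsSingularPair A μ X Y := by
  have left {Z : Mat m} (hZ : Z.IsHermitian) :
      (A * (X ⊗ₖ Z)).trace = μ * (Y * Z).trace := by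
    have linear_term : 2 * (μ * (Y * Z).trace.re - (A * (X ⊗ₖ Z)).trace.re) = 0 := by
      refine eq_zero_of_forall_quadratic_nonneg (a := μ * (Z * Z).trace.re) fun t => ?_
      have bound := h X (Y + t • Z) hX (hY.add (hZ.smul (.all t)))
      rw [re_trace_add_smul_mul_self] at bound
      simp only [kronecker_add, kronecker_smul, Matrix.mul_add, Matrix.mul_smul, trace_add,
        trace_smul, Complex.add_re, Complex.smul_re, smul_eq_mul] at bound
      linarith
    rw [← ofReal_re_trace_mul_of_isHermitian hA (isHermitian_kronecker hX hZ),
      ← ofReal_re_trace_mul_of_isHermitian hY hZ]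
    exact_mod_cast (by linarith : (A * (X ⊗ₖ Z)).trace.re = μ * (Y * Z).trace.re)
  have right {Z : Mat k} (hZ : Z.IsHermitian) :
      (A * (Z ⊗ₖ Y)).trace = μ * (X * Z).trace := by
    have linear_term : 2 * (μ * (X * Z).trace.re - (A * (Z ⊗ₖ Y)).trace.re) = 0 := by
      refine eq_zero_of_forall_quadratic_nonneg (a := μ * (Z * Z).trace.re) fun t => ?_
      have bound := h (X + t • Z) Y (hX.add (hZ.smul (.all t))) hY
      rw [re_trace_add_smul_mul_self] at bound
      simp only [add_kronecker, smul_kronecker, Matrix.mul_add, Matrix.mul_smul, trace_add,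
        trace_smul, Complex.add_re, Complex.smul_re, smul_eq_mul] at bound
      linarith
    rw [← ofReal_re_trace_mul_of_isHermitian hA (isHermitian_kronecker hZ hY),
      ← ofReal_re_trace_mul_of_isHermitian hX hZ]
    exact_mod_cast (by linarith : (A * (Z ⊗ₖ Y)).trace.re = μ * (X * Z).trace.re)
  refine ⟨hX, hY, fun Z => ?_, fun Z => ?_⟩ <;>
    obtain ⟨H, K, hH, hK, rfl⟩ := exists_eq_isHermitian_add_I_smul Z
  · simp only [kronecker_add, kronecker_smul, trace_add, trace_smul, left hH, left hK, mul_add,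
      mul_smul_comm]
  · simp only [add_kronecker, smul_kronecker, trace_add, trace_smul, right hH, right hK, mul_add,
      mul_smul_comm]

-- Since `A ≥ 0`, replacing `X = P - N` and `Y = Q - R` by their absolute values does not decrease
-- the form, so the two nonnegative defects of `(P, Q)` and `(N, R)` vanish.
theorem IsSingularPair.posPart {P N : Mat k} {Q R : Mat m} (hA : A.PosSemidef)
    (bound : IsSingularBound A μ) (h : IsSingularPair A μ (P - N) (Q - R)) (hP : P.PosSemidef)
    (hN : N.PosSemidef) (hQ : Q.PosSemidef) (hR : R.PosSemidef) (hPN : P * N = 0)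
    (hQR : Q * R = 0) : IsSingularPair A μ P Q := by
  refine bound.isSingularPair hA.isHermitian hP.isHermitian hQ.isHermitian ?_
  have cross_PR := (Complex.le_def.mp (trace_mul_nonneg_of_posSemidef hA (hP.kronecker hR))).1
  have cross_NQ := (Complex.le_def.mp (trace_mul_nonneg_of_posSemidef hA (hN.kronecker hQ))).1
  have bound_NR := bound N R hN.isHermitian hR.isHermitian
  have left := congrArg Complex.re (h.trace_left (Q - R))
  have right := congrArg Complex.re (h.trace_right (P - N))
  have hNP := (mul_eq_zero_comm_of_isHermitian hP.isHermitian hN.isHermitian).mp hPN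
  have hRQ := (mul_eq_zero_comm_of_isHermitian hQ.isHermitian hR.isHermitian).mp hQR
  rw [Complex.zero_re] at cross_PR cross_NQ
  simp only [Matrix.sub_mul, Matrix.mul_sub, sub_kronecker, kronecker_sub, hPN, hNP, hQR, hRQ,
    sub_zero, zero_sub, sub_neg_eq_add, trace_sub, trace_add, Complex.re_ofReal_mul,
    Complex.sub_re, Complex.add_re] at left right
  linarith

end SingularBound

section Schmidt

variable {k m : ℕ} {ι : Type} [DecidableEq ι]

theorem TraceOrthonormal.trace_mul {γ : ι → Mat k} (h : TraceOrthonormal γ)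
    (hγ : ∀ i, (γ i).IsHermitian) (i j : ι) : (γ i * γ j).trace = if i = j then 1 else 0 := by
  rw [← h i j, (hγ j).eq]

theorem TraceOrthonormal.comp {κ : Type} [DecidableEq κ] {γ : ι → Mat k} (h : TraceOrthonormal γ)
    {f : κ → ι} (hf : f.Injective) : TraceOrthonormal fun i => γ (f i) := fun i j => by
  rw [h, ite_congr (propext hf.eq_iff) (fun _ => rfl) fun _ => rfl]

theorem TraceOrthonormal.linearIndependent {γ : ι → Mat k} (h : TraceOrthonormal γ) :
    LinearIndependent ℂ γ := by
  refine linearIndependent_iff'.mpr fun s c hc i hi => ?_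
  have coeff := congrArg (fun M => (M * (γ i)ᴴ).trace) hc
  simpa only [Matrix.sum_mul, Matrix.smul_mul, trace_sum, trace_smul, h _ i, smul_eq_mul, mul_ite,
    mul_one, mul_zero, Finset.sum_ite_eq', if_pos hi, Matrix.zero_mul, trace_zero] using coeff

variable [Fintype ι]

theorem TraceOrthonormal.sum_sq_le {γ : ι → Mat k} (h : TraceOrthonormal γ)
    (hγ : ∀ i, (γ i).IsHermitian) {X : Mat k} (hX : X.IsHermitian) :
    ∑ i, (γ i * X).trace.re ^ 2 ≤ (X * X).trace.re := by
  set x : ι → ℝ := fun i => (γ i * X).trace.re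
  set S : Mat k := ∑ i, x i • γ i
  have hS : S.IsHermitian := isHermitian_sum _ fun i _ => (hγ i).smul (.all (x i))
  have trace_X_S : (X * S).trace.re = ∑ i, x i ^ 2 := by
    simp only [S, x, Matrix.mul_sum, Matrix.mul_smul, trace_sum, trace_smul, Complex.re_sum,
      Complex.smul_re, smul_eq_mul, trace_mul_comm X, sq]
  have trace_S_S : (S * S).trace.re = ∑ i, x i ^ 2 := by
    simp only [S, Matrix.mul_sum, Matrix.sum_mul, Matrix.mul_smul, Matrix.smul_mul, trace_sum,
      trace_smul, h.trace_mul hγ, smul_ite, smul_zero, Finset.sum_ite_eq', Finset.mem_univ,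
      if_true, Complex.re_sum, Complex.smul_re, Complex.one_re, smul_eq_mul, mul_one, sq]
  have residual_nonneg := (Complex.le_def.mp
    (trace_mul_self_nonneg_of_isHermitian (hX.add (hS.smul (.all (-1 : ℝ)))))).1
  rw [re_trace_add_smul_mul_self, trace_X_S, trace_S_S, Complex.zero_re] at residual_nonneg
  linarith

namespace IsHermitianSchmidtDecomposition

variable {A : BiMat k m} {c : ι → ℝ} {γ : ι → Mat k} {δ : ι → Mat m} {μ : ℝ} {X : Mat k} {Y : Mat m}

theorem isSingularPair (h : IsHermitianSchmidtDecomposition A c γ δ) (i : ι) :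
    IsSingularPair A (c i) (γ i) (δ i) where
  left_hermitian := h.left_hermitian i
  right_hermitian := h.right_hermitian i
  trace_left Z := by
    simp only [h.eq_sum, trace_sum_smul_kronecker_mul_kronecker,
      h.left_orthonormal.trace_mul h.left_hermitian, ite_mul, mul_ite, one_mul, zero_mul, mul_zero,
      Finset.sum_ite_eq', Finset.mem_univ, if_true]
  trace_right Z := by
    simp only [h.eq_sum, trace_sum_smul_kronecker_mul_kronecker,
      h.right_orthonormal.trace_mul h.right_hermitian, mul_ite, mul_one, mul_zero,
      Finset.sum_ite_eq', Finset.mem_univ, if_true]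

theorem isSingularBound (h : IsHermitianSchmidtDecomposition A c γ δ) (hμ : 0 ≤ μ)
    (hc : ∀ i, c i ≤ μ) : IsSingularBound A μ := fun X Y hX hY => by
  set x : ι → ℝ := fun i => (γ i * X).trace.re
  set y : ι → ℝ := fun i => (δ i * Y).trace.re
  have trace_eq : (A * (X ⊗ₖ Y)).trace.re = ∑ i, c i * (x i * y i) := by
    rw [h.eq_sum, trace_sum_smul_kronecker_mul_kronecker, Complex.re_sum]
    refine Finset.sum_congr rfl fun i _ => ?_
    rw [← ofReal_re_trace_mul_of_isHermitian (h.left_hermitian i) hX,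
      ← ofReal_re_trace_mul_of_isHermitian (h.right_hermitian i) hY]
    exact_mod_cast Complex.ofReal_re _
  calc 2 * (A * (X ⊗ₖ Y)).trace.re
      = ∑ i, c i * (2 * x i * y i) := by
        rw [trace_eq, Finset.mul_sum]
        exact Finset.sum_congr rfl fun i _ => by ring
    _ ≤ ∑ i, μ * (x i ^ 2 + y i ^ 2) := Finset.sum_le_sum fun i _ =>
        (mul_le_mul_of_nonneg_left (two_mul_le_add_sq _ _) (h.pos i).le).trans
          (mul_le_mul_of_nonneg_right (hc i) (by positivity))
    _ = μ * (∑ i, x i ^ 2 + ∑ i, y i ^ 2) := by rw [← Finset.mul_sum, Finset.sum_add_distrib]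
    _ ≤ μ * ((X * X).trace.re + (Y * Y).trace.re) := by
        gcongr
        · exact h.left_orthonormal.sum_sq_le h.left_hermitian hX
        · exact h.right_orthonormal.sum_sq_le h.right_hermitian hY

theorem trace_mul_eq_zero_of_isSingularPair (h : IsHermitianSchmidtDecomposition A c γ δ)
    (hμ : 0 < μ) (hXY : IsSingularPair A μ X Y) {i : ι} (hi : c i ≠ μ) :
    (γ i * X).trace = 0 ∧ (δ i * Y).trace = 0 :=
  (h.isSingularPair i).trace_mul_eq_zero hXY
    fun hsq => hi ((sq_eq_sq₀ (h.pos i).le hμ.le).mp hsq)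

theorem eq_sum_of_isSingularPair (h : IsHermitianSchmidtDecomposition A c γ δ) (hμ : 0 < μ)
    (hXY : IsSingularPair A μ X Y) :
    X = ∑ i, (γ i * X).trace.re • γ i ∧ Y = ∑ i, (γ i * X).trace.re • δ i := by
  have coeff_comm (i : ι) : c i * (δ i * Y).trace = μ * (γ i * X).trace := by
    by_cases hi : c i = μ
    · subst hi
      rw [(h.isSingularPair i).trace_mul_right_eq hμ.ne' hXY]
    · rw [(h.trace_mul_eq_zero_of_isSingularPair hμ hXY hi).1,
        (h.trace_mul_eq_zero_of_isSingularPair hμ hXY hi).2, mul_zero, mul_zero]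
  have coeff_comm' (i : ι) : c i * (γ i * X).trace = μ * (γ i * X).trace := by
    by_cases hi : c i = μ
    · rw [hi]
    · rw [(h.trace_mul_eq_zero_of_isSingularPair hμ hXY hi).1, mul_zero, mul_zero]
  simp only [← Complex.coe_smul, ofReal_re_trace_mul_of_isHermitian (h.left_hermitian _)
    hXY.left_hermitian]
  constructor <;> refine Matrix.ext_iff_trace_mul_right.mpr fun Z =>
    mul_left_cancel₀ (Complex.ofReal_ne_zero.mpr hμ.ne') ?_
  · rw [← hXY.trace_right, h.eq_sum, trace_sum_smul_kronecker_mul_kronecker, Matrix.sum_mul,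
      trace_sum, Finset.mul_sum]
    refine Finset.sum_congr rfl fun i _ => ?_
    rw [Matrix.smul_mul, trace_smul, smul_eq_mul]
    linear_combination (γ i * Z).trace * coeff_comm i
  · rw [← hXY.trace_left, h.eq_sum, trace_sum_smul_kronecker_mul_kronecker, Matrix.sum_mul,
      trace_sum, Finset.mul_sum]
    refine Finset.sum_congr rfl fun i _ => ?_
    rw [Matrix.smul_mul, trace_smul, smul_eq_mul]
    linear_combination (δ i * Z).trace * coeff_comm' i

theorem right_eq_left {A : BiMat k k} {c : ι → ℝ} {γ : ι → Mat k} {X Y : Mat k}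
    (h : IsHermitianSchmidtDecomposition A c γ γ) (hμ : 0 < μ) (hXY : IsSingularPair A μ X Y) :
    Y = X :=
  (h.eq_sum_of_isSingularPair hμ hXY).2.trans (h.eq_sum_of_isSingularPair hμ hXY).1.symm

end IsHermitianSchmidtDecomposition

end Schmidt

section TopSchmidt

variable {k m s t : ℕ} {A : BiMat k m} {μ : ℝ} {ν : Fin t → ℝ} {γ : Fin s ⊕ Fin t → Mat k}
  {δ : Fin s ⊕ Fin t → Mat m}

namespace IsHermitianSchmidtDecomposition

theorem eq_sum_inl_of_isSingularPair
    (h : IsHermitianSchmidtDecomposition A (Sum.elim (fun _ => μ) ν) γ δ) (hμ : 0 < μ)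
    (hν : ∀ j, ν j < μ) {X : Mat k} {Y : Mat m} (hXY : IsSingularPair A μ X Y) :
    X = ∑ i, (γ (Sum.inl i) * X).trace.re • γ (Sum.inl i) ∧
      Y = ∑ i, (γ (Sum.inl i) * X).trace.re • δ (Sum.inl i) := by
  have eq_sum := h.eq_sum_of_isSingularPair hμ hXY
  have trace_inr (j : Fin t) : (γ (Sum.inr j) * X).trace = 0 :=
    (h.trace_mul_eq_zero_of_isSingularPair hμ hXY (i := Sum.inr j) (hν j).ne).1
  simpa only [Fintype.sum_sum_type, trace_inr, Complex.zero_re, zero_smul, Finset.sum_const_zero,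
    add_zero] using eq_sum

theorem span_range_inl_eq_singularSpace
    (h : IsHermitianSchmidtDecomposition A (Sum.elim (fun _ => μ) ν) γ δ) (hμ : 0 < μ)
    (hν : ∀ j, ν j < μ) :
    Submodule.span ℝ (Set.range (γ ∘ Sum.inl)) = singularSpace A μ := by
  apply le_antisymm
  · rw [Submodule.span_le]
    rintro _ ⟨i, rfl⟩
    exact mem_singularSpace.mpr ⟨_, h.isSingularPair (Sum.inl i)⟩
  · intro X hX
    obtain ⟨Y, hXY⟩ := mem_singularSpace.mp hX
    rw [(h.eq_sum_inl_of_isSingularPair hμ hν hXY).1]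
    exact Submodule.sum_mem _ fun i _ =>
      Submodule.smul_mem _ _ (Submodule.subset_span ⟨i, rfl⟩)

theorem finrank_singularSpace
    (h : IsHermitianSchmidtDecomposition A (Sum.elim (fun _ => μ) ν) γ δ) (hμ : 0 < μ)
    (hν : ∀ j, ν j < μ) : Module.finrank ℝ (singularSpace A μ) = s := by
  have orthonormal : TraceOrthonormal (γ ∘ Sum.inl) := h.left_orthonormal.comp Sum.inl_injective
  rw [← h.span_range_inl_eq_singularSpace hμ hν,
    finrank_span_eq_card (orthonormal.linearIndependent.restrict_scalars' ℝ), Fintype.card_fin]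

theorem isSingularPair_of_isSingularPair_sum_inl
    (h : IsHermitianSchmidtDecomposition A (Sum.elim (fun _ => μ) ν) γ δ)
    {X : Mat k} {Y : Mat m}
    (hXY : IsSingularPair (∑ i, γ (Sum.inl i) ⊗ₖ δ (Sum.inl i)) 1 X Y) :
    IsSingularPair A μ X Y := by
  have top : IsHermitianSchmidtDecomposition (∑ i, γ (Sum.inl i) ⊗ₖ δ (Sum.inl i))
      (fun _ => 1) (fun i => γ (Sum.inl i)) (fun i => δ (Sum.inl i)) :=
    { pos := fun _ => one_pos
      left_hermitian := fun _ => h.left_hermitian _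
      right_hermitian := fun _ => h.right_hermitian _
      left_orthonormal := h.left_orthonormal.comp Sum.inl_injective
      right_orthonormal := h.right_orthonormal.comp Sum.inl_injective
      eq_sum := by simp only [Complex.ofReal_one, one_smul] }
  obtain ⟨hX, hY⟩ := top.eq_sum_of_isSingularPair one_pos hXY
  rw [hX, hY]
  exact .sum_smul (fun i => h.isSingularPair (Sum.inl i)) _

end IsHermitianSchmidtDecomposition

end TopSchmidt

section SpectralSpace

variable {k : ℕ}

/-- A set of pairwise annihilating nonzero positive semidefinite matrices. -/
structure IsPosSemidefOrthogonal (S : Set (Mat k)) : Prop where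
  posSemidef : ∀ X ∈ S, X.PosSemidef
  ne_zero : ∀ X ∈ S, X ≠ 0
  mul_eq_zero : S.Pairwise fun X Y => X * Y = 0

namespace IsPosSemidefOrthogonal

variable {S T : Set (Mat k)}

theorem empty : IsPosSemidefOrthogonal (∅ : Set (Mat k)) :=
  ⟨fun _ h => h.elim, fun _ h => h.elim, Set.pairwise_empty _⟩

theorem singleton {X : Mat k} (hX : X.PosSemidef) (hX₀ : X ≠ 0) : IsPosSemidefOrthogonal {X} :=
  ⟨fun _ h => h ▸ hX, fun _ h => h ▸ hX₀, Set.pairwise_singleton _ _⟩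

theorem union (hS : IsPosSemidefOrthogonal S) (hT : IsPosSemidefOrthogonal T)
    (hST : ∀ X ∈ S, ∀ Y ∈ T, X * Y = 0) : IsPosSemidefOrthogonal (S ∪ T) where
  posSemidef X hX := hX.elim (hS.posSemidef X) (hT.posSemidef X)
  ne_zero X hX := hX.elim (hS.ne_zero X) (hT.ne_zero X)
  mul_eq_zero := Set.pairwise_union.mpr ⟨hS.mul_eq_zero, hT.mul_eq_zero, fun X hX Y hY _ =>
    ⟨hST X hX Y hY, (mul_eq_zero_comm_of_isHermitian (hS.posSemidef X hX).isHermitian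
      (hT.posSemidef Y hY).isHermitian).mp (hST X hX Y hY)⟩⟩

theorem exists_traceOrthonormal_smul [DecidableEq S] (hS : IsPosSemidefOrthogonal S) :
    ∃ r : S → ℝ, (∀ X, 0 < r X) ∧ TraceOrthonormal fun X : S => r X • (X : Mat k) := by
  have hermitian (X : S) : (X : Mat k).IsHermitian := (hS.posSemidef X X.2).isHermitian
  have trace_nonneg (X : S) := trace_mul_self_nonneg_of_isHermitian (hermitian X)
  have trace_pos (X : S) : 0 < (X * X : Mat k).trace.re :=
    (Complex.lt_def.mp ((trace_nonneg X).lt_of_ne' fun h => hS.ne_zero X X.2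
      ((trace_mul_self_eq_zero_iff_of_isHermitian (hermitian X)).mp h))).1
  refine ⟨fun X => (√(X * X : Mat k).trace.re)⁻¹,
    fun X => inv_pos.mpr (Real.sqrt_pos.mpr (trace_pos X)), fun X Y => ?_⟩
  rw [conjTranspose_smul, star_trivial, (hermitian Y).eq, Matrix.smul_mul, Matrix.mul_smul,
    smul_smul, trace_smul]
  split_ifs with hXY
  · rw [hXY, ← mul_inv, Real.mul_self_sqrt (trace_pos Y).le, Complex.real_smul,
      Complex.ofReal_inv, ofReal_re_trace_mul_of_isHermitian (hermitian Y) (hermitian Y),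
      inv_mul_cancel₀ fun h => (trace_pos Y).ne' (congrArg Complex.re h)]
  · rw [hS.mul_eq_zero X.2 Y.2 (Subtype.coe_injective.ne hXY), trace_zero, smul_zero]

theorem exists_traceOrthonormal_span_eq (hS : IsPosSemidefOrthogonal S) :
    ∃ X : Fin (Module.finrank ℝ (Submodule.span ℝ S)) → Mat k, TraceOrthonormal X ∧
      (∀ i, (X i).PosSemidef) ∧ Submodule.span ℝ (Set.range X) = Submodule.span ℝ S := by
  classical
  obtain ⟨r, r_pos, orthonormal⟩ := hS.exists_traceOrthonormal_smul
  have span_eq : Submodule.span ℝ (Set.range fun X : S => r X • (X : Mat k)) =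
      Submodule.span ℝ S := by
    refine le_antisymm (Submodule.span_le.mpr ?_) (Submodule.span_le.mpr fun X hX => ?_)
    · rintro _ ⟨X, rfl⟩
      exact Submodule.smul_mem _ _ (Submodule.subset_span X.2)
    · exact (Submodule.smul_mem_iff _ (r_pos ⟨X, hX⟩).ne').mp (Submodule.subset_span ⟨⟨X, hX⟩, rfl⟩)
  have independent := orthonormal.linearIndependent.restrict_scalars' ℝ
  have : Finite S := independent.finite
  have : Fintype S := .ofFinite S
  have card_eq : Fintype.card S = Module.finrank ℝ (Submodule.span ℝ S) := by
    rw [← span_eq, finrank_span_eq_card independent]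
  let e := (Fintype.equivFinOfCardEq card_eq).symm
  refine ⟨fun i => r (e i) • (e i : Mat k), orthonormal.comp e.injective,
    fun i => (hS.posSemidef _ (e i).2).smul (r_pos _).le, ?_⟩
  rwa [← e.surjective.range_comp] at span_eq

end IsPosSemidefOrthogonal

/-- A real space of Hermitian matrices that contains the positive and negative parts of its
elements, and is commuted with and preserved by multiplication by the support projections `V` of
its positive semidefinite elements. -/
structure IsSpectralSpace (E : Submodule ℝ (Mat k)) : Prop where
  exists_posSemidef_sub : ∀ X ∈ E, ∃ P ∈ E, ∃ N ∈ E,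
    P.PosSemidef ∧ N.PosSemidef ∧ P * N = 0 ∧ X = P - N
  exists_support : ∀ X ∈ E, X.PosSemidef → ∃ V : Mat k, V * X = X ∧ (∃ Z, V = X * Z) ∧
    ∀ Y ∈ E, V * Y ∈ E ∧ V * Y = Y * V

/-- The elements of `E` whose columns are fixed by `V`. -/
def leftFixed (E : Submodule ℝ (Mat k)) (V : Mat k) : Submodule ℝ (Mat k) where
  carrier := {X | X ∈ E ∧ V * X = X}
  zero_mem' := ⟨E.zero_mem, Matrix.mul_zero V⟩
  add_mem' hX hY := ⟨E.add_mem hX.1 hY.1, by rw [Matrix.mul_add, hX.2, hY.2]⟩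
  smul_mem' r _ hX := ⟨E.smul_mem r hX.1, by rw [Matrix.mul_smul, hX.2]⟩

theorem mul_eq_self_of_mul_sub_eq_sub {V P N : Mat k} (hP : P.IsHermitian) (hNP : N * P = 0)
    (h : V * (P - N) = P - N) : V * P = P := by
  have annihilates : (V - 1) * (P * Pᴴ) = 0 := by
    rw [hP.eq, ← sub_zero (P * P), ← hNP, ← Matrix.sub_mul, ← Matrix.mul_assoc, Matrix.sub_mul,
      h, Matrix.one_mul, sub_self, Matrix.zero_mul, hNP]
  rwa [mul_self_mul_conjTranspose_eq_zero, Matrix.sub_mul, Matrix.one_mul, sub_eq_zero]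
    at annihilates

theorem leftFixed_sup_leftFixed_one_sub {E : Submodule ℝ (Mat k)} {V : Mat k} (hV : V * V = V)
    (hVE : ∀ Y ∈ E, V * Y ∈ E) : leftFixed E V ⊔ leftFixed E (1 - V) = E := by
  refine le_antisymm (sup_le (fun _ h => h.1) fun _ h => h.1) fun Y hY => ?_
  refine Submodule.mem_sup.mpr ⟨V * Y, ⟨hVE Y hY, ?_⟩, Y - V * Y,
    ⟨E.sub_mem hY (hVE Y hY), ?_⟩, add_sub_cancel _ _⟩
  · rw [← Matrix.mul_assoc, hV]
  · rw [Matrix.sub_mul, Matrix.one_mul, Matrix.mul_sub, ← Matrix.mul_assoc, hV, sub_self, sub_zero]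

theorem mul_eq_zero_of_mul_eq_self {V X Y : Mat k} (hVX : V * X = X * V) (hX : V * X = X)
    (hY : (1 - V) * Y = Y) : X * Y = 0 := by
  rw [← hY, ← Matrix.mul_assoc, Matrix.mul_sub, Matrix.mul_one, ← hVX, hX, sub_self,
    Matrix.zero_mul]

namespace IsSpectralSpace

variable {E : Submodule ℝ (Mat k)}

theorem isSpectralSpace_leftFixed (hE : IsSpectralSpace E) (V : Mat k) :
    IsSpectralSpace (leftFixed E V) where
  exists_posSemidef_sub := by
    rintro X ⟨hX, hVX⟩
    obtain ⟨P, hPE, N, hNE, hP, hN, hPN, rfl⟩ := hE.exists_posSemidef_sub X hX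
    have hNP := (mul_eq_zero_comm_of_isHermitian hP.isHermitian hN.isHermitian).mp hPN
    have hVP := mul_eq_self_of_mul_sub_eq_sub hP.isHermitian hNP hVX
    have hVN : V * N = N := by rwa [Matrix.mul_sub, hVP, sub_right_inj] at hVX
    exact ⟨P, ⟨hPE, hVP⟩, N, ⟨hNE, hVN⟩, hP, hN, hPN, rfl⟩
  exists_support := by
    rintro X ⟨hXE, hVX⟩ hX
    obtain ⟨U, hUX, ⟨Z, rfl⟩, hU⟩ := hE.exists_support X hXE hX
    exact ⟨X * Z, hUX, ⟨Z, rfl⟩, fun Y hY =>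
      ⟨⟨(hU Y hY.1).1, by simp only [← Matrix.mul_assoc, hVX]⟩, (hU Y hY.1).2⟩⟩

theorem exists_posSemidef_ne_zero (hE : IsSpectralSpace E) (hE₀ : E ≠ ⊥) :
    ∃ X ∈ E, X.PosSemidef ∧ X ≠ 0 := by
  obtain ⟨X, hX, hX₀⟩ := E.ne_bot_iff.mp hE₀
  obtain ⟨P, hPE, N, hNE, hP, hN, _, rfl⟩ := hE.exists_posSemidef_sub X hX
  by_cases hP₀ : P = 0
  · exact ⟨N, hNE, hN, fun hN₀ => hX₀ (by rw [hP₀, hN₀, sub_zero])⟩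
  · exact ⟨P, hPE, hP, hP₀⟩

-- Subtracting the multiple of `X` with the same trace from `Y` leaves a semidefinite matrix of
-- trace zero.
theorem mem_span_singleton (hE : IsSpectralSpace E)
    (indecomposable : ∀ P ∈ E, ∀ N ∈ E, P.PosSemidef → N.PosSemidef → P * N = 0 → P = 0 ∨ N = 0)
    {X Y : Mat k} (hXE : X ∈ E) (hX : X.PosSemidef) (hX₀ : X ≠ 0) (hY : Y ∈ E) :
    Y ∈ Submodule.span ℝ {X} := by
  have trace_re_eq_zero {P : Mat k} (hP : P.PosSemidef) (hP₀ : P.trace.re = 0) : P = 0 :=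
    hP.trace_eq_zero_iff.mp (Complex.ext hP₀ (Complex.le_def.mp hP.trace_nonneg).2.symm)
  have trace_X : X.trace.re ≠ 0 := fun h => hX₀ (trace_re_eq_zero hX h)
  set r := Y.trace.re / X.trace.re
  obtain ⟨P, hPE, N, hNE, hP, hN, hPN, eq_sub⟩ :=
    hE.exists_posSemidef_sub _ (E.sub_mem hY (E.smul_mem r hXE))
  have trace_eq : P.trace.re = N.trace.re := by
    rw [← sub_eq_zero, ← Complex.sub_re, ← trace_sub, ← eq_sub, trace_sub, trace_smul,
      Complex.sub_re, Complex.smul_re, smul_eq_mul, div_mul_cancel₀ _ trace_X, sub_self]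
  have hP₀ : P = 0 ∧ N = 0 := by
    rcases indecomposable P hPE N hNE hP hN hPN with rfl | rfl
    · exact ⟨rfl, trace_re_eq_zero hN (by rw [← trace_eq, trace_zero, Complex.zero_re])⟩
    · exact ⟨trace_re_eq_zero hP (by rw [trace_eq, trace_zero, Complex.zero_re]), rfl⟩
  rw [hP₀.1, hP₀.2, sub_zero, sub_eq_zero] at eq_sub
  exact Submodule.mem_span_singleton.mpr ⟨r, eq_sub.symm⟩

theorem exists_idempotent_leftFixed_lt (hE : IsSpectralSpace E) {P N : Mat k} (hPE : P ∈ E)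
    (hNE : N ∈ E) (hP : P.PosSemidef) (hN : N.PosSemidef) (hPN : P * N = 0) (hP₀ : P ≠ 0)
    (hN₀ : N ≠ 0) : ∃ V : Mat k, V * V = V ∧ (∀ Y ∈ E, V * Y ∈ E ∧ V * Y = Y * V) ∧
      leftFixed E V < E ∧ leftFixed E (1 - V) < E := by
  obtain ⟨V, hVP, ⟨Z, hPZ⟩, hV⟩ := hE.exists_support P hPE hP
  have hNP := (mul_eq_zero_comm_of_isHermitian hP.isHermitian hN.isHermitian).mp hPN
  have hVN : V * N = 0 := by rw [(hV N hNE).2, hPZ, ← Matrix.mul_assoc, hNP, Matrix.zero_mul]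
  have hVV : V * V = V :=
    calc V * V = V * P * Z := by rw [Matrix.mul_assoc, ← hPZ]
      _ = V := by rw [hVP, ← hPZ]
  refine ⟨V, hVV, hV, SetLike.lt_iff_le_and_exists.mpr ⟨fun _ h => h.1, N, hNE, fun h => ?_⟩,
    SetLike.lt_iff_le_and_exists.mpr ⟨fun _ h => h.1, P, hPE, fun h => ?_⟩⟩
  · exact hN₀ (h.2.symm.trans hVN)
  · refine hP₀ (h.2.symm.trans ?_)
    rw [Matrix.sub_mul, Matrix.one_mul, hVP, sub_self]

theorem exists_isPosSemidefOrthogonal_span_eq (hE : IsSpectralSpace E) :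
    ∃ S : Set (Mat k), IsPosSemidefOrthogonal S ∧ Submodule.span ℝ S = E := by
  induction finrank_eq : Module.finrank ℝ E using Nat.strong_induction_on generalizing E with
  | _ d ih =>
  subst finrank_eq
  by_cases indecomposable :
      ∀ P ∈ E, ∀ N ∈ E, P.PosSemidef → N.PosSemidef → P * N = 0 → P = 0 ∨ N = 0
  · rcases eq_or_ne E ⊥ with rfl | hE₀
    · exact ⟨∅, .empty, Submodule.span_empty⟩
    obtain ⟨X, hXE, hX, hX₀⟩ := hE.exists_posSemidef_ne_zero hE₀
    exact ⟨{X}, .singleton hX hX₀,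
      le_antisymm ((Submodule.span_singleton_le_iff_mem X E).mpr hXE) fun Y hY =>
        hE.mem_span_singleton indecomposable hXE hX hX₀ hY⟩
  · push Not at indecomposable
    obtain ⟨P, hPE, N, hNE, hP, hN, hPN, hP₀, hN₀⟩ := indecomposable
    obtain ⟨V, hVV, hV, lt_left, lt_right⟩ :=
      hE.exists_idempotent_leftFixed_lt hPE hNE hP hN hPN hP₀ hN₀
    obtain ⟨S, hS, span_S⟩ :=
      ih _ (Submodule.finrank_lt_finrank_of_lt lt_left) (hE.isSpectralSpace_leftFixed V) rfl
    obtain ⟨T, hT, span_T⟩ := ih _ (Submodule.finrank_lt_finrank_of_lt lt_right)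
      (hE.isSpectralSpace_leftFixed (1 - V)) rfl
    refine ⟨S ∪ T, hS.union hT fun X hX Y hY => ?_, ?_⟩
    · have hXV : X ∈ leftFixed E V := span_S ▸ Submodule.subset_span hX
      have hYV : Y ∈ leftFixed E (1 - V) := span_T ▸ Submodule.subset_span hY
      exact mul_eq_zero_of_mul_eq_self (hV X hXV.1).2 hXV.2 hYV.2
    · rw [Submodule.span_union, span_S, span_T,
        leftFixed_sup_leftFixed_one_sub hVV fun Y hY => (hV Y hY).1]

end IsSpectralSpace

end SpectralSpace

section PositiveTop

variable {k m : ℕ} {A : BiMat k m} {μ : ℝ}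

theorem TraceOrthonormal.eq_sum_of_mem_span {ι : Type} [Fintype ι] [DecidableEq ι] {γ : ι → Mat k}
    (h : TraceOrthonormal γ) (hγ : ∀ i, (γ i).IsHermitian) {X : Mat k}
    (hX : X ∈ Submodule.span ℝ (Set.range γ)) : X = ∑ i, (γ i * X).trace.re • γ i := by
  obtain ⟨x, rfl⟩ := (Submodule.mem_span_range_iff_exists_fun ℝ).mp hX
  refine Finset.sum_congr rfl fun i _ => ?_
  simp only [Matrix.mul_sum, Matrix.mul_smul, trace_sum, trace_smul, h.trace_mul hγ, smul_ite,
    smul_zero, Finset.sum_ite_eq, Finset.mem_univ, if_true, Complex.smul_re, Complex.one_re,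
    smul_eq_mul, mul_one]

-- Both sides are the tensor of the isometry `X ↦ Y` defined by the singular pairs.
theorem IsSingularPair.sum_kronecker_eq_sum_kronecker {ι κ : Type} [Fintype ι] [DecidableEq ι]
    [Fintype κ] [DecidableEq κ] {X : ι → Mat k} {Y : ι → Mat m} {γ : κ → Mat k} {δ : κ → Mat m}
    (hμ : μ ≠ 0) (hXY : ∀ i, IsSingularPair A μ (X i) (Y i))
    (hγδ : ∀ j, IsSingularPair A μ (γ j) (δ j)) (hX : TraceOrthonormal X) (hγ : TraceOrthonormal γ)
    (span_eq : Submodule.span ℝ (Set.range X) = Submodule.span ℝ (Set.range γ)) :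
    ∑ i, X i ⊗ₖ Y i = ∑ j, γ j ⊗ₖ δ j := by
  have left_eq (i : ι) : X i = ∑ j, (γ j * X i).trace.re • γ j :=
    hγ.eq_sum_of_mem_span (fun j => (hγδ j).left_hermitian)
      (span_eq ▸ Submodule.subset_span ⟨i, rfl⟩)
  have right_eq (j : κ) : δ j = ∑ i, (γ j * X i).trace.re • Y i := by
    refine (hγδ j).right_unique hμ ?_
    have γ_eq := hX.eq_sum_of_mem_span (fun i => (hXY i).left_hermitian)
      (span_eq ▸ Submodule.subset_span ⟨j, rfl⟩ : γ j ∈ Submodule.span ℝ (Set.range X))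
    simp only [trace_mul_comm _ (γ j)] at γ_eq
    have combination := IsSingularPair.sum_smul hXY fun i => (γ j * X i).trace.re
    rwa [← γ_eq] at combination
  calc ∑ i, X i ⊗ₖ Y i
      = ∑ i, ∑ j, (γ j * X i).trace.re • (γ j ⊗ₖ Y i) := by
        refine Finset.sum_congr rfl fun i _ => ?_
        conv_lhs => rw [left_eq i, sum_kronecker]
        simp only [smul_kronecker]
    _ = ∑ j, ∑ i, (γ j * X i).trace.re • (γ j ⊗ₖ Y i) := Finset.sum_comm
    _ = ∑ j, γ j ⊗ₖ δ j := by
        refine Finset.sum_congr rfl fun j _ => ?_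
        conv_rhs => rw [right_eq j, kronecker_sum]
        simp only [kronecker_smul]

/-- Every positive semidefinite left singular vector `X` of `A` with singular value `μ` splits `A`
into two blocks, the left one given by the projection `V` onto the image of `X`. -/
def SplitsAtSingularPairs (A : BiMat k m) (μ : ℝ) : Prop :=
  ∀ (X : Mat k) (Y : Mat m), IsSingularPair A μ X Y → X.PosSemidef →
    ∃ (V : Mat k) (W : Mat m), IsHermitianProjectionOnto V (Set.range X.mulVec) ∧
      IsBlockDecomposition A ![V, 1 - V] ![W, 1 - W]

theorem SplitsAtSingularPairs.isSpectralSpace (splits : SplitsAtSingularPairs A μ)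
    (hA : A.PosSemidef) (bound : IsSingularBound A μ) (hμ : μ ≠ 0) :
    IsSpectralSpace (singularSpace A μ) where
  exists_posSemidef_sub X hX := by
    obtain ⟨Y, hXY⟩ := mem_singularSpace.mp hX
    obtain ⟨P, N, hP, hN, rfl, hPN⟩ := exists_posSemidef_sub_of_isHermitian hXY.left_hermitian
    obtain ⟨Q, R, hQ, hR, rfl, hQR⟩ := exists_posSemidef_sub_of_isHermitian hXY.right_hermitian
    have hPE : P ∈ singularSpace A μ :=
      mem_singularSpace.mpr ⟨Q, hXY.posPart hA bound hP hN hQ hR hPN hQR⟩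
    exact ⟨P, hPE, N, sub_sub_self P N ▸ Submodule.sub_mem _ hPE hX, hP, hN, hPN, rfl⟩
  exists_support X hXE hX := by
    obtain ⟨Y, hXY⟩ := mem_singularSpace.mp hXE
    obtain ⟨V, W, hV, hVW⟩ := splits X Y hXY hX
    refine ⟨V, hV.mul_range_self, hV.exists_eq_range_mul, fun X' hX' => ?_⟩
    obtain ⟨Y', hXY'⟩ := mem_singularSpace.mp hX'
    exact ⟨mem_singularSpace.mpr ⟨W * Y', hXY'.block_mul hμ hVW 0⟩,
      hXY'.block_mul_left_comm hμ hVW 0⟩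

theorem IsHermitianSchmidtDecomposition.exists_posSemidef_of_splitsAtSingularPairs {s t : ℕ}
    {ν : Fin t → ℝ} {γ : Fin s ⊕ Fin t → Mat k} {δ : Fin s ⊕ Fin t → Mat m}
    (h : IsHermitianSchmidtDecomposition A (Sum.elim (fun _ => μ) ν) γ δ) (hμ : 0 < μ)
    (hν : ∀ j, ν j < μ) (hA : A.PosSemidef) (splits : SplitsAtSingularPairs A μ) :
    ∃ (γ' : Fin s → Mat k) (δ' : Fin s → Mat m),
      IsHermitianSchmidtDecomposition (∑ i, γ (Sum.inl i) ⊗ₖ δ (Sum.inl i)) (fun _ => 1) γ' δ' ∧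
      (∀ i, (γ' i).PosSemidef) ∧ ∀ i, (δ' i).PosSemidef := by
  have bound : IsSingularBound A μ :=
    h.isSingularBound hμ.le (Sum.rec (fun _ => le_rfl) fun j => (hν j).le)
  have span_eq := h.span_range_inl_eq_singularSpace hμ hν
  have orthonormal_inl : TraceOrthonormal (γ ∘ Sum.inl) :=
    h.left_orthonormal.comp Sum.inl_injective
  obtain ⟨S, hS, span_S⟩ :=
    (splits.isSpectralSpace hA bound hμ.ne').exists_isPosSemidefOrthogonal_span_eq
  have basis := hS.exists_traceOrthonormal_span_eq
  rw [span_S, h.finrank_singularSpace hμ hν] at basis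
  obtain ⟨γ', orthonormal, hγ', span_γ'⟩ := basis
  choose δ' hγδ' using fun i =>
    mem_singularSpace.mp (span_γ'.le (Submodule.subset_span ⟨i, rfl⟩) : γ' i ∈ _)
  refine ⟨γ', δ',
    { pos := fun _ => one_pos
      left_hermitian := fun i => (hγδ' i).left_hermitian
      right_hermitian := fun i => (hγδ' i).right_hermitian
      left_orthonormal := orthonormal
      right_orthonormal := fun i j => ?_
      eq_sum := ?_ }, hγ', fun i => (hγδ' i).right_posSemidef hA hμ (hγ' i)⟩
  · rw [(hγδ' j).right_hermitian.eq, (hγδ' i).trace_mul_right_eq hμ.ne' (hγδ' j),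
      orthonormal.trace_mul fun i => (hγδ' i).left_hermitian]
  · simp only [Complex.ofReal_one, one_smul]
    exact (IsSingularPair.sum_kronecker_eq_sum_kronecker hμ.ne' hγδ'
      (fun i => h.isSingularPair (Sum.inl i)) orthonormal orthonormal_inl
      (span_γ'.trans span_eq.symm)).symm

end PositiveTop

section HermitianSpace

variable {k m : ℕ} {A : BiMat k m}

/-- The real vector space of Hermitian matrices, made a Euclidean space by `⟨X, Y⟩ = tr (X Y)`. -/
noncomputable abbrev HermitianMat (k : ℕ) : Submodule ℝ (Mat k) := selfAdjoint.submodule ℝ (Mat k)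

/-- The inner product `tr (X Y)` on Hermitian matrices. -/
@[reducible]
noncomputable def hermitianInnerProductCore (k : ℕ) :
    InnerProductSpace.Core ℝ (HermitianMat k) where
  inner X Y := ((X : Mat k) * (Y : Mat k)).trace.re
  conj_inner_symm X Y := by rw [trace_mul_comm]; rfl
  re_inner_nonneg X := (Complex.le_def.mp (trace_mul_self_nonneg_of_isHermitian X.2)).1
  add_left X Y Z := by
    rw [Submodule.coe_add, Matrix.add_mul, trace_add, Complex.add_re]
  smul_left X Y r := by
    rw [Submodule.coe_smul, Matrix.smul_mul, trace_smul, Complex.smul_re]; rfl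
  definite X hX := Subtype.ext <| (trace_mul_self_eq_zero_iff_of_isHermitian X.2).mp <| by
    rw [← ofReal_re_trace_mul_of_isHermitian X.2 X.2, hX, Complex.ofReal_zero]

noncomputable instance : NormedAddCommGroup (HermitianMat k) :=
  (hermitianInnerProductCore k).toNormedAddCommGroup

noncomputable instance : InnerProductSpace ℝ (HermitianMat k) :=
  .ofCore (hermitianInnerProductCore k).toCore

theorem HermitianMat.ofReal_inner (X Y : HermitianMat k) :
    ((inner ℝ X Y : ℝ) : ℂ) = ((X : Mat k) * (Y : Mat k)).trace :=
  ofReal_re_trace_mul_of_isHermitian X.2 Y.2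

theorem HermitianMat.traceOrthonormal_of_orthonormal {ι : Type} [DecidableEq ι]
    {u : ι → HermitianMat k} (hu : Orthonormal ℝ u) : TraceOrthonormal fun i => (u i : Mat k) :=
  fun i j => by
    rw [show (u j : Mat k)ᴴ = u j from (u j).2, ← HermitianMat.ofReal_inner,
      orthonormal_iff_ite.mp hu i j]
    split_ifs <;> simp only [Complex.ofReal_one, Complex.ofReal_zero]

/-- The partial trace `Tr₁ (A (X ⊗ 1))`, as a linear map in `X`. -/
def leftContraction (A : BiMat k m) : Mat k →ₗ[ℂ] Mat m where
  toFun X := of fun i j => ∑ p, ∑ q, A (p, i) (q, j) * X q p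
  map_add' X Y := by
    ext i j
    simp only [of_apply, Matrix.add_apply, mul_add, Finset.sum_add_distrib]
  map_smul' c X := by
    ext i j
    simp only [of_apply, Matrix.smul_apply, RingHom.id_apply, smul_eq_mul, Finset.mul_sum,
      mul_left_comm c]

theorem trace_leftContraction_mul (A : BiMat k m) (X : Mat k) (Y : Mat m) :
    (leftContraction A X * Y).trace = (A * (X ⊗ₖ Y)).trace := by
  simp only [trace, diag_apply, mul_apply, leftContraction, LinearMap.coe_mk, AddHom.coe_mk,
    of_apply, Fintype.sum_prod_type, kronecker_apply, Finset.sum_mul, mul_assoc]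
  conv_rhs => rw [Finset.sum_comm]
  exact Finset.sum_congr rfl fun i _ => Finset.sum_comm.trans <|
    Finset.sum_congr rfl fun p _ => Finset.sum_comm

theorem isHermitian_leftContraction (hA : A.IsHermitian) {X : Mat k} (hX : X.IsHermitian) :
    (leftContraction A X).IsHermitian := by
  ext i j
  simp only [leftContraction, conjTranspose_apply, LinearMap.coe_mk, AddHom.coe_mk, of_apply,
    star_sum, star_mul', hA.apply, hX.apply]
  exact Finset.sum_comm

/-- `leftContraction A` on Hermitian matrices, for Hermitian `A`. -/
noncomputable def hermitianContraction (hA : A.IsHermitian) : HermitianMat k →ₗ[ℝ] HermitianMat m :=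
  ((leftContraction A).restrictScalars ℝ).restrict fun _ => isHermitian_leftContraction hA

theorem ofReal_inner_hermitianContraction (hA : A.IsHermitian) (X : HermitianMat k)
    (Y : HermitianMat m) :
    ((inner ℝ (hermitianContraction hA X) Y : ℝ) : ℂ) = (A * ((X : Mat k) ⊗ₖ (Y : Mat m))).trace :=
  (HermitianMat.ofReal_inner _ _).trans (trace_leftContraction_mul A X Y)

theorem BiMat.ext_trace_mul_kronecker_hermitian {A B : BiMat k m}
    (h : ∀ (X : HermitianMat k) (Y : HermitianMat m), (A * ((X : Mat k) ⊗ₖ (Y : Mat m))).trace =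
      (B * ((X : Mat k) ⊗ₖ (Y : Mat m))).trace) : A = B := by
  refine BiMat.ext_trace_mul_kronecker fun X Y => ?_
  obtain ⟨X₁, X₂, hX₁, hX₂, rfl⟩ := exists_eq_isHermitian_add_I_smul X
  obtain ⟨Y₁, Y₂, hY₁, hY₂, rfl⟩ := exists_eq_isHermitian_add_I_smul Y
  simp only [add_kronecker, kronecker_add, smul_kronecker, kronecker_smul, mul_add,
    mul_smul_comm, trace_add, trace_smul, h ⟨X₁, hX₁⟩ ⟨Y₁, hY₁⟩, h ⟨X₁, hX₁⟩ ⟨Y₂, hY₂⟩,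
    h ⟨X₂, hX₂⟩ ⟨Y₁, hY₁⟩, h ⟨X₂, hX₂⟩ ⟨Y₂, hY₂⟩]

theorem eq_sum_kronecker_hermitianContraction (hA : A.IsHermitian) {ι : Type} [Fintype ι]
    (b : OrthonormalBasis ι ℝ (HermitianMat k)) :
    A = ∑ i, (b i : Mat k) ⊗ₖ (hermitianContraction hA (b i) : Mat m) := by
  refine BiMat.ext_trace_mul_kronecker_hermitian fun X Y => ?_
  simp only [Matrix.sum_mul, trace_sum, trace_kronecker_mul_kronecker,
    ← HermitianMat.ofReal_inner, ← ofReal_inner_hermitianContraction hA]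
  norm_cast
  conv_lhs => rw [← b.sum_repr' X, map_sum, sum_inner]
  simp only [map_smul, real_inner_smul_left]

end HermitianSpace

section SingularBasis

variable {E F : Type*} [NormedAddCommGroup E] [InnerProductSpace ℝ E] [NormedAddCommGroup F]
  [InnerProductSpace ℝ F] [FiniteDimensional ℝ E] [FiniteDimensional ℝ F]

theorem exists_orthonormalBasis_orthonormal_normalize_map (G : E →ₗ[ℝ] F) :
    ∃ b : OrthonormalBasis (Fin (Module.finrank ℝ E)) ℝ E,
      Orthonormal ℝ fun i : {i // ‖G (b i)‖ ≠ 0} => ‖G (b i)‖⁻¹ • G (b i) := by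
  have symm := G.isSymmetric_adjoint_comp_self
  refine ⟨symm.eigenvectorBasis rfl, fun i => norm_smul_inv_norm (norm_ne_zero_iff.mp i.2),
    fun i j hij => ?_⟩
  beta_reduce
  rw [real_inner_smul_left, real_inner_smul_right, ← LinearMap.adjoint_inner_left,
    ← LinearMap.comp_apply, symm.apply_eigenvectorBasis, real_inner_smul_left,
    (symm.eigenvectorBasis rfl).inner_eq_zero (Subtype.coe_ne_coe.mpr hij), mul_zero, mul_zero,
    mul_zero]

end SingularBasis

section SchmidtExistence

variable {k m : ℕ} {ι : Type} [Fintype ι] [DecidableEq ι]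

namespace IsHermitianSchmidtDecomposition

variable {A : BiMat k m} {c : ι → ℝ} {γ : ι → Mat k} {δ : ι → Mat m}

theorem restrict_support (hc : ∀ i, 0 ≤ c i) (hγ : ∀ i, (γ i).IsHermitian)
    (hδ : ∀ i, (δ i).IsHermitian) (left_orthonormal : TraceOrthonormal γ)
    (right_orthonormal : TraceOrthonormal fun i : {i // c i ≠ 0} => δ i)
    (eq_sum : A = ∑ i, (c i : ℂ) • (γ i ⊗ₖ δ i)) :
    IsHermitianSchmidtDecomposition A (fun i : {i // c i ≠ 0} => c i) (fun i => γ i)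
      fun i => δ i where
  pos i := (hc i).lt_of_ne' i.2
  left_hermitian i := hγ i
  right_hermitian i := hδ i
  left_orthonormal := left_orthonormal.comp Subtype.val_injective
  right_orthonormal := right_orthonormal
  eq_sum := by
    have sum_zero : ∑ i : {i // ¬ c i ≠ 0}, (c i : ℂ) • (γ i ⊗ₖ δ i) = 0 :=
      Finset.sum_eq_zero fun i _ => by rw [not_not.mp i.2, Complex.ofReal_zero, zero_smul]
    rw [eq_sum, ← Fintype.sum_subtype_add_sum_subtype (fun i => c i ≠ 0), sum_zero, add_zero]

theorem reindex {κ : Type} [Fintype κ] [DecidableEq κ]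
    (h : IsHermitianSchmidtDecomposition A c γ δ) (f : κ ≃ ι) :
    IsHermitianSchmidtDecomposition A (c ∘ f) (γ ∘ f) (δ ∘ f) where
  pos _ := h.pos _
  left_hermitian _ := h.left_hermitian _
  right_hermitian _ := h.right_hermitian _
  left_orthonormal := h.left_orthonormal.comp f.injective
  right_orthonormal := h.right_orthonormal.comp f.injective
  eq_sum := h.eq_sum.trans (f.sum_comp fun i => (c i : ℂ) • (γ i ⊗ₖ δ i)).symm

theorem exists_top (h : IsHermitianSchmidtDecomposition A c γ δ) (hA : A ≠ 0) :
    ∃ (s t : ℕ) (μ : ℝ) (ν : Fin t → ℝ) (f : Fin s ⊕ Fin t ≃ ι), 1 ≤ s ∧ (∀ j, ν j < μ) ∧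
      IsHermitianSchmidtDecomposition A (Sum.elim (fun _ => μ) ν) (γ ∘ f) (δ ∘ f) := by
  have : Nonempty ι := by
    by_contra isEmpty
    rw [not_nonempty_iff] at isEmpty
    exact hA (h.eq_sum.trans (Fintype.sum_empty _))
  obtain ⟨top, le_top⟩ := Finite.exists_max c
  let attained := Fintype.equivFin {i // c i = c top}
  let smaller := Fintype.equivFin {i // ¬ c i = c top}
  let f := (Equiv.sumCongr attained.symm smaller.symm).trans (Equiv.sumCompl (c · = c top))
  refine ⟨_, _, c top, fun j => c (smaller.symm j), f, Fintype.card_pos_iff.mpr ⟨⟨top, rfl⟩⟩,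
    fun j => (le_top _).lt_of_ne (smaller.symm j).2, ?_⟩
  have coeff_eq : c ∘ f = Sum.elim (fun _ => c top) fun j => c (smaller.symm j) := by
    funext i
    rcases i with i | j
    exacts [(attained.symm i).2, rfl]
  exact coeff_eq ▸ h.reindex f

end IsHermitianSchmidtDecomposition

theorem exists_isHermitianSchmidtDecomposition {A : BiMat k m} (hA : A.IsHermitian) :
    ∃ (ι : Type) (_ : Fintype ι) (_ : DecidableEq ι) (c : ι → ℝ) (γ : ι → Mat k) (δ : ι → Mat m),
      IsHermitianSchmidtDecomposition A c γ δ := by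
  set G := hermitianContraction hA
  obtain ⟨b, orthonormal⟩ := exists_orthonormalBasis_orthonormal_normalize_map G
  refine ⟨_, _, _, _, _, _, .restrict_support (c := fun i => ‖G (b i)‖) (γ := fun i => b i)
    (δ := fun i => (‖G (b i)‖⁻¹ • G (b i) : HermitianMat m)) (fun _ => norm_nonneg _)
    (fun i => (b i).2) (fun i => (‖G (b i)‖⁻¹ • G (b i)).2)
    (HermitianMat.traceOrthonormal_of_orthonormal b.orthonormal)
    (HermitianMat.traceOrthonormal_of_orthonormal orthonormal) ?_⟩
  rw [eq_sum_kronecker_hermitianContraction hA b]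
  refine Finset.sum_congr rfl fun i _ => ?_
  rw [Complex.coe_smul, ← kronecker_smul, ← Submodule.coe_smul, smul_smul]
  by_cases norm_eq : ‖G (b i)‖ = 0
  · rw [norm_eq_zero.mp norm_eq, smul_zero]
  · rw [mul_inv_cancel₀ norm_eq, one_smul]

theorem isSPC_iff {A : BiMat k k} :
    IsSPC A ↔ A.PosSemidef ∧ (∀ X Y, (A * (X ⊗ₖ Y)).trace = (A * (Y ⊗ₖ X)).trace) ∧
      ∀ X : Mat k, X.IsHermitian → 0 ≤ (A * (X ⊗ₖ X)).trace := by
  refine and_congr_right fun hA => ⟨?_, ?_⟩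
  · rintro ⟨n, c, γ, h⟩
    simp only [h.eq_sum, trace_sum_smul_kronecker_mul_kronecker]
    refine ⟨fun X Y => Finset.sum_congr rfl fun i _ => by rw [mul_comm (trace _)],
      fun X hX => Finset.sum_nonneg fun i _ => ?_⟩
    rw [← ofReal_re_trace_mul_of_isHermitian (h.left_hermitian i) hX]
    exact_mod_cast mul_nonneg (h.pos i).le (mul_self_nonneg _)
  · rintro ⟨comm, nonneg⟩
    set G := hermitianContraction hA.isHermitian
    have symm : G.IsSymmetric := fun X Y => by
      rw [← Complex.ofReal_inj, ofReal_inner_hermitianContraction, comm,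
        ← ofReal_inner_hermitianContraction, real_inner_comm]
    set b := symm.eigenvectorBasis rfl
    have apply_b (i) : G (b i) = symm.eigenvalues rfl i • b i := symm.apply_eigenvectorBasis rfl i
    have orthonormal := HermitianMat.traceOrthonormal_of_orthonormal b.orthonormal
    have eigenvalue_nonneg (i) : 0 ≤ symm.eigenvalues rfl i := by
      have := nonneg (b i) (b i).2
      rw [← ofReal_inner_hermitianContraction hA.isHermitian, apply_b, real_inner_smul_left,
        real_inner_self_eq_norm_sq, b.norm_eq_one, one_pow, mul_one] at this
      exact_mod_cast this
    have h := IsHermitianSchmidtDecomposition.restrict_support (A := A) eigenvalue_nonneg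
      (fun i => (b i).2) (fun i => (b i).2) orthonormal
      (orthonormal.comp Subtype.val_injective) <| by
        rw [eq_sum_kronecker_hermitianContraction hA.isHermitian b]
        refine Finset.sum_congr rfl fun i _ => ?_
        rw [Complex.coe_smul, ← kronecker_smul, ← Submodule.coe_smul, ← apply_b]
    exact ⟨_, _, _, h.reindex (Fintype.equivFin _).symm⟩

end SchmidtExistence

section Splitting

variable {k m : ℕ} {A : BiMat k m} {μ : ℝ} {X V : Mat k} {Y W : Mat m}

namespace IsSingularPair

theorem mul_projection_kronecker_eq_zero (h : IsSingularPair A μ X Y) (hA : A.PosSemidef)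
    (hX : X.PosSemidef) (hV : IsHermitianProjectionOnto V (Set.range X.mulVec)) {Q : Mat m}
    (hQ : Q.PosSemidef) (hYQ : Y * Q = 0) : A * (V ⊗ₖ Q) = 0 := by
  obtain ⟨Z, rfl⟩ := hV.exists_eq_range_mul
  rw [← Matrix.mul_one Q, mul_kronecker_mul, ← Matrix.mul_assoc,
    h.mul_kronecker_eq_zero_of_mul_eq_zero hA hX hQ hYQ, Matrix.zero_mul]

theorem mul_kronecker_projection_eq_zero (h : IsSingularPair A μ X Y) (hA : A.PosSemidef)
    (hY : Y.PosSemidef) (hW : IsHermitianProjectionOnto W (Set.range Y.mulVec)) {Q : Mat k}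
    (hQ : Q.PosSemidef) (hXQ : X * Q = 0) : A * (Q ⊗ₖ W) = 0 := by
  obtain ⟨Z, rfl⟩ := hW.exists_eq_range_mul
  rw [← Matrix.mul_one Q, mul_kronecker_mul, ← Matrix.mul_assoc,
    h.kronecker_mul_eq_zero_of_mul_eq_zero hA hY hQ hXQ, Matrix.zero_mul]

theorem mul_kronecker_complement_eq_zero (h : IsSingularPair A μ X Y) (hA : A.PosSemidef)
    (hX : X.PosSemidef) (hY : Y.PosSemidef)
    (hV : IsHermitianProjectionOnto V (Set.range X.mulVec))
    (hW : IsHermitianProjectionOnto W (Set.range Y.mulVec)) (i j : Fin 2) (hij : i ≠ j) :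
    A * (![V, 1 - V] i ⊗ₖ ![W, 1 - W] j) = 0 := by
  have mul_complement {n : ℕ} {P ε : Mat n} (hP : IsHermitianProjectionOnto P (Set.range ε.mulVec))
      (hε : ε.IsHermitian) : ε * (1 - P) = 0 := by
    rw [← hP.mul_eq_zero_iff hε, Matrix.mul_sub, Matrix.mul_one, hP.1.2, sub_self]
  fin_cases i <;> fin_cases j
  · exact absurd rfl hij
  · exact h.mul_projection_kronecker_eq_zero hA hX hV hW.1.one_sub.posSemidef
      (mul_complement hW hY.isHermitian)
  · exact h.mul_kronecker_projection_eq_zero hA hY hW hV.1.one_sub.posSemidef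
      (mul_complement hV hX.isHermitian)
  · exact absurd rfl hij

end IsSingularPair

theorem IsPPT.splitsAtSingularPairs (hA : IsPPT A) (hμ : 0 < μ) : SplitsAtSingularPairs A μ :=
  fun X Y hXY hX => by
  obtain ⟨V, hV⟩ := exists_isHermitianProjectionOnto_range X
  obtain ⟨W, hW⟩ := exists_isHermitianProjectionOnto_range Y
  exact ⟨V, W, hV, hA.isBlockDecomposition hV.1.isOrthogonalResolution
    hW.1.isOrthogonalResolution <| hXY.mul_kronecker_complement_eq_zero hA.1 hX
      (hXY.right_posSemidef hA.1 hμ hX) hV hW⟩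

theorem IsSPC.splitsAtSingularPairs {A : BiMat k k} (hA : IsSPC A) (hμ : 0 < μ) :
    SplitsAtSingularPairs A μ := fun X Y hXY hX => by
  obtain ⟨-, n, c, γ, h⟩ := id hA
  obtain rfl := h.right_eq_left hμ hXY
  obtain ⟨V, hV⟩ := exists_isHermitianProjectionOnto_range Y
  exact ⟨V, V, hV, hA.isBlockDecomposition hV.1.isOrthogonalResolution <|
    hXY.mul_kronecker_complement_eq_zero hA.1 hX hX hV hV⟩

theorem IsSingularPair.isWeakIrreducible (h : IsSingularPair A μ X Y) (hμ : μ ≠ 0)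
    (hA : A.PosSemidef) (hX : X ≠ 0) (finrank_eq_one : Module.finrank ℝ (singularSpace A μ) = 1)
    (kronecker_one_mul : ∀ Z, Z * X = 0 → (Z ⊗ₖ 1) * A = 0) : IsWeakIrreducible A := by
  refine ⟨hA, fun V₁ V₂ W₁ W₂ hV₁ _ hW₁ _ _ _ hV hW eq_add => ?_⟩
  obtain rfl : V₂ = 1 - V₁ := eq_sub_of_add_eq' hV
  obtain rfl : W₂ = 1 - W₁ := eq_sub_of_add_eq' hW
  have blocks : IsBlockDecomposition A ![V₁, 1 - V₁] ![W₁, 1 - W₁] :=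
    ⟨hV₁.isOrthogonalResolution, hW₁.isOrthogonalResolution, by
      simpa only [Fin.sum_univ_two, cons_val_zero, cons_val_one] using eq_add⟩
  have compress_eq_zero {Z : Mat k} (U : Mat m) (hZ : Z * X = 0) : compress Z U A = 0 := by
    rw [compress, ← Matrix.one_mul Z, ← Matrix.mul_one U, mul_kronecker_mul,
      Matrix.mul_assoc (1 ⊗ₖ U), kronecker_one_mul Z hZ, Matrix.mul_zero, Matrix.zero_mul]
  obtain ⟨r, hr⟩ : ∃ r : ℝ, r • X = V₁ * X := by
    obtain ⟨r, hr⟩ := (finrank_eq_one_iff_of_nonzero' (V := singularSpace A μ)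
      ⟨X, mem_singularSpace.mpr ⟨Y, h⟩⟩ (Subtype.coe_ne_coe.mp hX)).mp finrank_eq_one
      ⟨V₁ * X, mem_singularSpace.mpr ⟨W₁ * Y, h.block_mul hμ blocks 0⟩⟩
    exact ⟨r, congrArg Subtype.val hr⟩
  have idempotent : r * r = r := smul_left_injective ℝ hX <| by
    beta_reduce
    rw [mul_smul, hr, ← Matrix.mul_smul, hr, ← Matrix.mul_assoc, hV₁.2]
  rcases IsIdempotentElem.iff_eq_zero_or_one.mp idempotent with rfl | rfl
  · exact .inl (compress_eq_zero W₁ (by rw [← hr, zero_smul]))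
  · exact .inr (compress_eq_zero _ (by
      rw [Matrix.sub_mul, Matrix.one_mul, ← hr, one_smul, sub_self]))

end Splitting

section SplitData

variable {k m s t : ℕ} {A : BiMat k m} {μ : ℝ} {ν : Fin t → ℝ} {γ : Fin s ⊕ Fin t → Mat k}
  {δ : Fin s ⊕ Fin t → Mat m} {γ' : Fin s → Mat k} {δ' : Fin s → Mat m}
  {V : Fin (s + 1) → Mat k} {W : Fin (s + 1) → Mat m}

theorem TraceOrthonormal.mul_eq_zero_of_posSemidef {ι : Type} [DecidableEq ι] {γ : ι → Mat k}
    (h : TraceOrthonormal γ) (hγ : ∀ i, (γ i).PosSemidef) (i j : ι) (hij : i ≠ j) :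
    γ i * γ j = 0 :=
  mul_eq_zero_of_posSemidef_of_trace_mul_eq_zero (hγ i) (hγ j) <| by
    rw [h.trace_mul fun i => (hγ i).isHermitian, if_neg hij]

namespace IsSplitData

theorem pos (h : IsSplitData A μ ν γ δ γ' δ' V W) : 0 < μ := h.schmidt.pos (Sum.inl ⟨0, h.one_le⟩)

theorem isSingularPair (h : IsSplitData A μ ν γ δ γ' δ' V W) (i : Fin s) :
    IsSingularPair A μ (γ' i) (δ' i) :=
  h.schmidt.isSingularPair_of_isSingularPair_sum_inl (h.schmidt_top.isSingularPair i)

theorem left_ne_zero (h : IsSplitData A μ ν γ δ γ' δ' V W) (i : Fin s) : γ' i ≠ 0 :=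
  h.schmidt_top.left_orthonormal.linearIndependent.ne_zero i

theorem left_isOrthogonalResolution (h : IsSplitData A μ ν γ δ γ' δ' V W) :
    IsOrthogonalResolution V :=
  h.left_projections.isOrthogonalResolution h.schmidt_top.left_hermitian
    (h.schmidt_top.left_orthonormal.mul_eq_zero_of_posSemidef h.left_posSemidef)

theorem right_isOrthogonalResolution (h : IsSplitData A μ ν γ δ γ' δ' V W) :
    IsOrthogonalResolution W :=
  h.right_projections.isOrthogonalResolution h.schmidt_top.right_hermitian
    (h.schmidt_top.right_orthonormal.mul_eq_zero_of_posSemidef h.right_posSemidef)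

theorem mul_kronecker_eq_zero (h : IsSplitData A μ ν γ δ γ' δ' V W) (hA : A.PosSemidef)
    (i j : Fin (s + 1)) (hij : i ≠ j) : A * (V i ⊗ₖ W j) = 0 := by
  have hV := h.left_isOrthogonalResolution
  have hW := h.right_isOrthogonalResolution
  induction i using Fin.lastCases with
  | cast a =>
    refine (h.isSingularPair a).mul_projection_kronecker_eq_zero hA (h.left_posSemidef a)
      (h.left_projections.1 a) (hW.projection j).posSemidef ?_
    rw [← (h.right_projections.1 a).mul_eq_zero_iff (h.schmidt_top.right_hermitian a)]
    exact hW.mul_eq_zero _ _ hij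
  | last => induction j using Fin.lastCases with
    | last => exact absurd rfl hij
    | cast b =>
      refine (h.isSingularPair b).mul_kronecker_projection_eq_zero hA (h.right_posSemidef b)
        (h.right_projections.1 b) (hV.projection (Fin.last s)).posSemidef ?_
      rw [← (h.left_projections.1 b).mul_eq_zero_iff (h.schmidt_top.left_hermitian b)]
      exact hV.mul_eq_zero _ _ hij.symm

theorem isBlockDecomposition_of_isPPT (h : IsSplitData A μ ν γ δ γ' δ' V W) (hA : IsPPT A) :
    IsBlockDecomposition A V W :=
  hA.isBlockDecomposition h.left_isOrthogonalResolution h.right_isOrthogonalResolution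
    (h.mul_kronecker_eq_zero hA.1)

theorem isBlockDecomposition_of_isSPC {A : BiMat k k} {γ : Fin s ⊕ Fin t → Mat k}
    (h : IsSplitData A μ ν γ γ γ' γ' V V) (hA : IsSPC A) : IsBlockDecomposition A V V :=
  hA.isBlockDecomposition h.left_isOrthogonalResolution (h.mul_kronecker_eq_zero hA.1)

theorem compress_castSucc_ne_zero (h : IsSplitData A μ ν γ δ γ' δ' V W)
    (blocks : IsBlockDecomposition A V W) (i : Fin s) :
    compress (V i.castSucc) (W i.castSucc) A ≠ 0 := fun compress_eq_zero => by
  have trace_eq := (h.isSingularPair i).trace_left (δ' i)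
  rw [← (h.left_projections.1 i).mul_range_self, ← Matrix.one_mul (δ' i), mul_kronecker_mul,
    ← Matrix.mul_assoc, blocks.mul_kronecker_one, compress_eq_zero, Matrix.zero_mul, trace_zero,
    Matrix.one_mul, h.schmidt_top.right_orthonormal.trace_mul h.schmidt_top.right_hermitian,
    if_pos rfl, mul_one] at trace_eq
  exact h.pos.ne (Complex.ofReal_eq_zero.mp trace_eq.symm).symm

theorem isWeakIrreducible (h : IsSplitData A μ ν γ δ γ' δ' V W)
    (blocks : IsBlockDecomposition A V W) (hA : A.PosSemidef) {a : Fin s} (ha : ∀ i, i = a)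
    (last_eq_zero : compress (V (Fin.last s)) (W (Fin.last s)) A = 0) : IsWeakIrreducible A := by
  have eq_compress : A = compress (V a.castSucc) (W a.castSucc) A := by
    conv_lhs => rw [blocks.eq_sum, Fin.sum_univ_castSucc, last_eq_zero, add_zero]
    exact Fintype.sum_eq_single a fun b hb => absurd (ha b) hb
  have s_eq_one : s = 1 := by
    rw [← Fintype.card_fin s, Fintype.card_eq_one_iff]
    exact ⟨a, ha⟩
  refine (h.isSingularPair a).isWeakIrreducible h.pos.ne' hA (h.left_ne_zero a)
    ((h.schmidt.finrank_singularSpace h.pos h.lt_top).trans s_eq_one) fun Z hZ => ?_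
  obtain ⟨T, hT⟩ := (h.left_projections.1 a).exists_eq_range_mul
  rw [eq_compress, ← blocks.kronecker_one_mul, ← Matrix.mul_assoc, ← mul_kronecker_mul, hT,
    ← Matrix.mul_assoc, hZ, Matrix.zero_mul, zero_kronecker, Matrix.zero_mul]

theorem tensorRank_lt (h : IsSplitData A μ ν γ δ γ' δ' V W) (blocks : IsBlockDecomposition A V W)
    (hA : A.PosSemidef) (reducible : ¬ IsWeakIrreducible A) (i : Fin (s + 1)) :
    tensorRank (compress (V i) (W i) A) < tensorRank A := by
  have ne_zero := h.compress_castSucc_ne_zero blocks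
  induction i using Fin.lastCases with
  | last =>
    exact blocks.tensorRank_compress_lt (Fin.castSucc_ne_last ⟨0, h.one_le⟩).symm (ne_zero _)
  | cast a =>
    by_cases last_eq_zero : compress (V (Fin.last s)) (W (Fin.last s)) A = 0
    · obtain ⟨b, hb⟩ : ∃ b, b ≠ a := not_forall.mp fun ha =>
        reducible (h.isWeakIrreducible blocks hA ha last_eq_zero)
      exact blocks.tensorRank_compress_lt ((Fin.castSucc_injective s).ne hb.symm) (ne_zero b)
    · exact blocks.tensorRank_compress_lt (Fin.castSucc_ne_last a) last_eq_zero

end IsSplitData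

theorem IsPPT.exists_isPPTSplitDecomposition (hA : IsPPT A) (hA₀ : A ≠ 0) :
    ∃ (s : ℕ) (T : Fin (s + 1) → BiMat k m), IsPPTSplitDecomposition s A T := by
  obtain ⟨ι, _, _, c, γ, δ, h⟩ := exists_isHermitianSchmidtDecomposition hA.1.isHermitian
  obtain ⟨s, t, μ, ν, f, hs, hν, h⟩ := h.exists_top hA₀
  have hμ : 0 < μ := h.pos (Sum.inl ⟨0, hs⟩)
  obtain ⟨γ', δ', top, hγ', hδ'⟩ :=
    h.exists_posSemidef_of_splitsAtSingularPairs hμ hν hA.1 (hA.splitsAtSingularPairs hμ)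
  obtain ⟨V, hV⟩ := exists_isProjectionSystem γ'
  obtain ⟨W, hW⟩ := exists_isProjectionSystem δ'
  exact ⟨s, _, t, μ, ν, _, _, γ', δ', V, W, ⟨hs, hν, h, top, hγ', hδ', hV, hW⟩, fun _ => rfl⟩

theorem IsSPC.exists_isSPCSplitDecomposition {A : BiMat k k} (hA : IsSPC A) (hA₀ : A ≠ 0) :
    ∃ (s : ℕ) (T : Fin (s + 1) → BiMat k k), IsSPCSplitDecomposition s A T := by
  obtain ⟨-, n, c, γ, h⟩ := id hA
  obtain ⟨s, t, μ, ν, f, hs, hν, h⟩ := h.exists_top hA₀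
  have hμ : 0 < μ := h.pos (Sum.inl ⟨0, hs⟩)
  obtain ⟨γ', δ', top, hγ', -⟩ :=
    h.exists_posSemidef_of_splitsAtSingularPairs hμ hν hA.1 (hA.splitsAtSingularPairs hμ)
  obtain rfl : δ' = γ' := funext fun i => h.right_eq_left hμ
    (h.isSingularPair_of_isSingularPair_sum_inl (top.isSingularPair i))
  obtain ⟨V, hV⟩ := exists_isProjectionSystem δ'
  exact ⟨s, _, t, μ, ν, _, δ', V, ⟨hs, hν, h, top, hγ', hγ', hV, hV⟩, fun _ => rfl⟩

theorem trace_compress_mul_kronecker (V X : Mat k) (W Y : Mat m) (A : BiMat k m) :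
    (compress V W A * (X ⊗ₖ Y)).trace = (A * ((V * X * V) ⊗ₖ (W * Y * W))).trace := by
  rw [compress, Matrix.mul_assoc, Matrix.mul_assoc, trace_mul_comm, Matrix.mul_assoc,
    ← mul_kronecker_mul, ← mul_kronecker_mul]

theorem IsSPC.compress {A : BiMat k k} (hA : IsSPC A) {V : Mat k} (hV : V.IsHermitian) :
    IsSPC (compress V V A) := by
  rw [isSPC_iff] at hA ⊢
  obtain ⟨posSemidef, comm, nonneg⟩ := hA
  simp only [trace_compress_mul_kronecker]
  refine ⟨posSemidef_compress posSemidef hV hV, fun X Y => comm _ _, fun X hX => nonneg _ ?_⟩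
  simpa only [hV.eq] using isHermitian_mul_mul_conjTranspose V hX

end SplitData

section Reduction

variable {k m : ℕ} {P : BiMat k m → Prop}
  {step : (s : ℕ) → BiMat k m → (Fin (s + 1) → BiMat k m) → Prop} {A : BiMat k m}

/-- A procedure that splits every nonzero matrix of the class `P` into matrices of the class `P`,
in a way that preserves separability and makes the tensor rank drop as long as the matrix is not
weak irreducible. -/
structure IsSplittingProcedure (P : BiMat k m → Prop)
    (step : (s : ℕ) → BiMat k m → (Fin (s + 1) → BiMat k m) → Prop) : Prop where
  exists_step : ∀ A, P A → A ≠ 0 → ∃ (s : ℕ) (T : Fin (s + 1) → BiMat k m), step s A T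
  eq_sum : ∀ A, P A → ∀ s T, step s A T → A = ∑ i, T i
  mem : ∀ A, P A → ∀ s T, step s A T → ∀ i, P (T i)
  isSeparableMatrix_iff : ∀ A, P A → ∀ s T, step s A T →
    (IsSeparableMatrix A ↔ ∀ i, IsSeparableMatrix (T i))
  tensorRank_lt : ∀ A, P A → ∀ s T, step s A T →
    ¬ IsWeakIrreducible A → ∀ i, tensorRank (T i) < tensorRank A

theorem isSplittingProcedure_isPPT :
    IsSplittingProcedure (k := k) (m := m) IsPPT IsPPTSplitDecomposition where
  exists_step _ hA hA₀ := hA.exists_isPPTSplitDecomposition hA₀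
  eq_sum := by
    rintro A hA s T ⟨t, μ, ν, γ, δ, γ', δ', V, W, h, hT⟩
    simpa only [hT] using (h.isBlockDecomposition_of_isPPT hA).eq_sum
  mem := by
    rintro A hA s T ⟨t, μ, ν, γ, δ, γ', δ', V, W, h, hT⟩ i
    rw [hT]
    exact hA.compress (h.left_isOrthogonalResolution.projection i).1
      (h.right_isOrthogonalResolution.projection i).1
  isSeparableMatrix_iff := by
    rintro A hA s T ⟨t, μ, ν, γ, δ, γ', δ', V, W, h, hT⟩
    simpa only [hT] using (h.isBlockDecomposition_of_isPPT hA).isSeparableMatrix_iff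
  tensorRank_lt := by
    rintro A hA s T ⟨t, μ, ν, γ, δ, γ', δ', V, W, h, hT⟩ reducible i
    rw [hT]
    exact h.tensorRank_lt (h.isBlockDecomposition_of_isPPT hA) hA.1 reducible i

theorem isSplittingProcedure_isSPC :
    IsSplittingProcedure (k := k) (m := k) IsSPC IsSPCSplitDecomposition where
  exists_step _ hA hA₀ := hA.exists_isSPCSplitDecomposition hA₀
  eq_sum := by
    rintro A hA s T ⟨t, μ, ν, γ, γ', V, h, hT⟩
    simpa only [hT] using (h.isBlockDecomposition_of_isSPC hA).eq_sum
  mem := by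
    rintro A hA s T ⟨t, μ, ν, γ, γ', V, h, hT⟩ i
    rw [hT]
    exact hA.compress (h.left_isOrthogonalResolution.projection i).1
  isSeparableMatrix_iff := by
    rintro A hA s T ⟨t, μ, ν, γ, γ', V, h, hT⟩
    simpa only [hT] using (h.isBlockDecomposition_of_isSPC hA).isSeparableMatrix_iff
  tensorRank_lt := by
    rintro A hA s T ⟨t, μ, ν, γ, γ', V, h, hT⟩ reducible i
    rw [hT]
    exact h.tensorRank_lt (h.isBlockDecomposition_of_isSPC hA) hA.1 reducible i

theorem isWeakIrreducible_zero : IsWeakIrreducible (0 : BiMat k m) :=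
  ⟨.zero, fun _ _ _ _ _ _ _ _ _ _ _ _ _ => .inl (compress_zero _ _)⟩

namespace IsSplittingProcedure

theorem exists_splitReduction (h : IsSplittingProcedure P step) (hA : P A) :
    ∃ L, SplitReduction step A L := by
  induction rank_eq : tensorRank A using Nat.strong_induction_on generalizing A with
  | _ r ih =>
  subst rank_eq
  by_cases irreducible : IsWeakIrreducible A
  · exact ⟨[A], .keep A irreducible⟩
  · obtain ⟨s, T, hT⟩ :=
      h.exists_step A hA fun hA₀ => irreducible (hA₀ ▸ isWeakIrreducible_zero)
    choose L hL using fun i =>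
      ih _ (h.tensorRank_lt A hA s T hT irreducible i) (h.mem A hA s T hT i) rfl
    exact ⟨_, .split A s T L irreducible hT hL⟩

theorem forall_mem_splitReduction (h : IsSplittingProcedure P step) (hA : P A)
    {L : List (BiMat k m)} (hL : SplitReduction step A L) :
    ∀ B ∈ L, P B ∧ IsWeakIrreducible B := by
  induction hL with
  | keep A irreducible => exact List.forall_mem_singleton.mpr ⟨hA, irreducible⟩
  | split A s T L _ hT _ ih =>
    simp only [List.forall_mem_flatten, List.forall_mem_ofFn_iff]
    exact fun i => ih i (h.mem A hA s T hT i)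

theorem isSeparableMatrix_iff_forall_mem (h : IsSplittingProcedure P step) (hA : P A)
    {L : List (BiMat k m)} (hL : SplitReduction step A L) :
    IsSeparableMatrix A ↔ ∀ B ∈ L, IsSeparableMatrix B := by
  induction hL with
  | keep A _ => exact List.forall_mem_singleton.symm
  | split A s T L _ hT _ ih =>
    simp only [List.forall_mem_flatten, List.forall_mem_ofFn_iff]
    exact (h.isSeparableMatrix_iff A hA s T hT).trans
      (forall_congr' fun i => ih i (h.mem A hA s T hT i))

theorem isSeparableMatrix_iff_forall_mem_criterion (h : IsSplittingProcedure P step) (hA : P A)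
    {L : List (BiMat k m)} (hL : SplitReduction step A L) {Q : BiMat k m → Prop}
    (hQ : ∀ B, P B → IsWeakIrreducible B → (Q B ↔ IsSeparableMatrix B)) :
    IsSeparableMatrix A ↔ ∀ B ∈ L, Q B :=
  (h.isSeparableMatrix_iff_forall_mem hA hL).trans <| forall₂_congr fun B hB =>
    (hQ B (h.forall_mem_splitReduction hA hL B hB).1
      (h.forall_mem_splitReduction hA hL B hB).2).symm

end IsSplittingProcedure

end Reduction

theorem mainTheorem6 :
    (∀ (k : ℕ) (A : BiMat k k), IsSPC A →
      (A ≠ 0 → ∃ (s : ℕ) (T : Fin (s + 1) → BiMat k k), IsSPCSplitDecomposition s A T) ∧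
      (∀ (s : ℕ) (T : Fin (s + 1) → BiMat k k), IsSPCSplitDecomposition s A T →
        A = ∑ i, T i ∧
        (∀ i, IsSPC (T i)) ∧
        (IsSeparableMatrix A ↔ ∀ i, IsSeparableMatrix (T i)) ∧
        (¬ IsWeakIrreducible A → ∀ i, tensorRank (T i) < tensorRank A)) ∧
      (∃ L : List (BiMat k k), SplitReduction IsSPCSplitDecomposition A L) ∧
      (∀ L : List (BiMat k k), SplitReduction IsSPCSplitDecomposition A L →
        (∀ B ∈ L, IsSPC B ∧ IsWeakIrreducible B) ∧
        (∀ Q : BiMat k k → Prop,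
          (∀ B : BiMat k k, IsSPC B → IsWeakIrreducible B → (Q B ↔ IsSeparableMatrix B)) →
          (IsSeparableMatrix A ↔ ∀ B ∈ L, Q B)))) ∧
    (∀ (k m : ℕ) (A : BiMat k m), IsPPT A →
      (A ≠ 0 → ∃ (s : ℕ) (T : Fin (s + 1) → BiMat k m), IsPPTSplitDecomposition s A T) ∧
      (∀ (s : ℕ) (T : Fin (s + 1) → BiMat k m), IsPPTSplitDecomposition s A T →
        A = ∑ i, T i ∧
        (∀ i, IsPPT (T i)) ∧
        (IsSeparableMatrix A ↔ ∀ i, IsSeparableMatrix (T i)) ∧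
        (¬ IsWeakIrreducible A → ∀ i, tensorRank (T i) < tensorRank A)) ∧
      (∃ L : List (BiMat k m), SplitReduction IsPPTSplitDecomposition A L) ∧
      (∀ L : List (BiMat k m), SplitReduction IsPPTSplitDecomposition A L →
        (∀ B ∈ L, IsPPT B ∧ IsWeakIrreducible B) ∧
        (∀ Q : BiMat k m → Prop,
          (∀ B : BiMat k m, IsPPT B → IsWeakIrreducible B → (Q B ↔ IsSeparableMatrix B)) →
          (IsSeparableMatrix A ↔ ∀ B ∈ L, Q B)))) := by
  refine ⟨fun k A hA => ?_, fun k m A hA => ?_⟩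
  · have h := isSplittingProcedure_isSPC (k := k)
    exact ⟨h.exists_step A hA, fun s T hT => ⟨h.eq_sum A hA s T hT, h.mem A hA s T hT,
      h.isSeparableMatrix_iff A hA s T hT, h.tensorRank_lt A hA s T hT⟩,
      h.exists_splitReduction hA, fun L hL => ⟨h.forall_mem_splitReduction hA hL,
      fun Q => h.isSeparableMatrix_iff_forall_mem_criterion hA hL⟩⟩
  · have h := isSplittingProcedure_isPPT (k := k) (m := m)
    exact ⟨h.exists_step A hA, fun s T hT => ⟨h.eq_sum A hA s T hT, h.mem A hA s T hT,
      h.isSeparableMatrix_iff A hA s T hT, h.tensorRank_lt A hA s T hT⟩,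
      h.exists_splitReduction hA, fun L hL => ⟨h.forall_mem_splitReduction hA hL,
      fun Q => h.isSeparableMatrix_iff_forall_mem_criterion hA hL⟩⟩
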